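/- **Setting.** Let $g,\eta_p,\lambda>0$. A state is $(h,u,\sigma_{xx},\sigma_{zz})$ with $h\ge 0$, $\sigma_{xx},\sigma_{zz}>0$; put $q=(h,hu,h\sigma_{xx},h\sigma_{zz})$, $P=g\frac{h^2}{2}+\frac{\eta_p}{2\lambda}h(\sigma_{zz}-\sigma_{xx})$, $F(q)=(hu,\,hu^2+P,\,h\sigma_{xx}u,\,h\sigma_{zz}u)$, and, for a bottom level $b$, $$\widetilde E(q,b)=\tfrac12hu^2+\tfrac g2h^2+ghb+\tfrac{\eta_p}{4\lambda}h\bigl(\sigma_{xx}+\sigma_{zz}-\ln(\sigma_{xx}\sigma_{zz})-2\bigr),\qquad \widetilde G(q,b)=(\widetilde E(q,b)+P)u .$$ Consider the system $$\partial_tq+\partial_xF(q)=\bigl(0,\,-gh\,\partial_xb,\,2h\sigma_{xx}\partial_xu,\,-2h\sigma_{zz}\partial_xu\bigr).\tag{S}$$ **Riemann solver without topography.** Given states $q_l,q_r$, let $a=\sqrt{gh+\frac{\eta_p}{2\lambda}(3\sigma_{zz}+\sigma_{xx})}$ and $$\frac{c_l}{h_l}=a_l+2\Bigl((u_l-u_r)_++\tfrac{(P_r-P_l)_+}{h_la_l+h_ra_r}\Bigr),\qquad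 \frac{c_r}{h_r}=a_r+2\Bigl((u_l-u_r)_++\tfrac{(P_l-P_r)_+}{h_la_l+h_ra_r}\Bigr),$$ $$u_*=\tfrac{c_lu_l+c_ru_r+P_l-P_r}{c_l+c_r},\qquad \pi_*=\tfrac{c_rP_l+c_lP_r-c_lc_r(u_r-u_l)}{c_l+c_r},$$ $$\tfrac1{h_l^*}=\tfrac1{h_l}+\tfrac{c_r(u_r-u_l)+P_l-P_r}{c_l(c_l+c_r)},\qquad \tfrac1{h_r^*}=\tfrac1{h_r}+\tfrac{c_l(u_r-u_l)+P_r-P_l}{c_r(c_l+c_r)},$$ $\sigma_{xx,j}^*=\sigma_{xx,j}(h_j/h_j^*)^2$, $\sigma_{zz,j}^*=\sigma_{zz,j}(h_j^*/h_j)^2$ for $j=l,r$. Put $\Sigma_1=u_l-c_l/h_l$, $\Sigma_2=u_*$, $\Sigma_3=u_r+c_r/h_r$ and $A(q_l,q_r)=\max_k|\Sigma_k|$. The fluxes $\mathcal F_l(q_l,q_r),\mathcal F_r(q_l,q_r)$ have the same first two components $hu$ and $hu^2+\pi$, evaluated on the values $l$ (with $\pi=P_l$) if $\Sigma_1\ge0$,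 $l*$ (with $\pi=\pi_*$) if $\Sigma_1\le0\le\Sigma_2$, $r*$ (with $\pi=\pi_*$) if $\Sigma_2\le0\le\Sigma_3$, $r$ (with $\pi=P_r$) if $\Sigma_3\le0$. For $f=h\sigma_{xx}$ and $f=h\sigma_{zz}$ the last two components are $$\mathcal F_l^f=f_lu_l+\min(0,\Sigma_1)(f_l^*-f_l)+\min(0,\Sigma_2)(f_r^*-f_l^*)+\min(0,\Sigma_3)(f_r-f_r^*),$$ $$\mathcal F_r^f=f_ru_r-\max(0,\Sigma_1)(f_l^*-f_l)-\max(0,\Sigma_2)(f_r^*-f_l^*)-\max(0,\Sigma_3)(f_r-f_r^*).$$ If exactly one of $h_l,h_r$ vanishes, the intermediate height on that side is $0$, with the corresponding $f^*=0$. If both vanish, all fluxes are $0$, $(P_r-P_l)_+/0$ and $(P_l-P_r)_+/0$ are read as $0$, and $\Sigma_2$ is set to $0$. **Scheme with topography.** With $\Delta b=b_r-b_l$ and $x_+=\max(0,x)$, let $h_l^\sharp=(h_l-(\Delta b)_+)_+$, $h_r^\sharp=(h_r-(-\Delta b)_+)_+$; let $q_l^\sharp,q_r^\sharp$ be the states with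 these heights and unchanged $u,\sigma_{xx},\sigma_{zz}$; and $$F_j(q_l,q_r,\Delta b)=\mathcal F_j(q_l^\sharp,q_r^\sharp)+\bigl(0,\;\tfrac g2h_j^2-\tfrac g2(h_j^{\sharp})^2,\,0,\,0\bigr),\qquad j=l,r .$$ On a mesh $(\Delta x_i)_{i\in\mathbb Z}$, $\Delta x_i>0$, with bottom levels $b_i$, $\Delta b_{i+1/2}=b_{i+1}-b_i$, and time step $\Delta t>0$, the scheme is $$q_i^{n+1}=q_i^n-\frac{\Delta t}{\Delta x_i}\Bigl(F_l(q_i^n,q_{i+1}^n,\Delta b_{i+1/2})-F_r(q_{i-1}^n,q_i^n,\Delta b_{i-1/2})\Bigr).$$ **Theorem.** The scheme has the following properties. (i) *Consistency with (S) for smooth solutions.* $F_l(q,q,0)=F_r(q,q,0)=F(q)$ for all states. At each state $q$ with $h>0$, as $(q_l,q_r,\Delta b)\to(q,q,0)$ (in the variables $h,u,\sigma_{xx},\sigma_{zz}$), both $F_l$ and $F_r$ tend to $F(q)$, and $$F_r-F_l=\bigl(0,-gh\Delta b,2h\sigma_{xx}(u_r-u_l),-2h\sigma_{zz}(u_r-u_l)\bigr)+o\bigl(|h_l-h_r|+|u_l-u_r|+|\sigma_{xx,l}-\sigma_{xx,r}|+|\sigma_{zz,l}-\sigma_{zz,r}|+|\Delta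 b|\bigr).$$ If $b$ is $C^1$ on $\mathbb R$ and $(h,u,\sigma_{xx},\sigma_{zz})$ is a $C^1$ solution of (S) with $h,\sigma_{xx},\sigma_{zz}>0$ on an open set of $(t,x)$, then on uniform meshes the truncation error $$\tfrac{q(t+\Delta t,x)-q(t,x)}{\Delta t}+\tfrac{1}{\Delta x}\Bigl(F_l\bigl(q(t,x),q(t,x+\Delta x),b(x+\Delta x)-b(x)\bigr)-F_r\bigl(q(t,x-\Delta x),q(t,x),b(x)-b(x-\Delta x)\bigr)\Bigr)$$ tends to $0$ at each point of that set as $\Delta t,\Delta x\to0^+$. (ii) *Positivity.* If all $q_i^n$ are states and, at every interface, $\Delta t\,A(q_i^\sharp,q_{i+1}^\sharp)\le\frac12\min(\Delta x_i,\Delta x_{i+1})$, where $q_i^\sharp,q_{i+1}^\sharp$ are the reconstructed states there, then every $q_i^{n+1}$ is the $q$-vector of a state ($h\ge0$, $\sigma_{xx},\sigma_{zz}>0$), and $h_i^n>0$ implies $h_i^{n+1},(h\sigma_{xx})_i^{n+1},(h\sigma_{zz})_i^{n+1}>0$. (iii) *Conservativity in $h$.* The $h$-components of $F_l$ and $F_r$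 coincide; hence for $m\le n'$ the mass $\sum_{m\le i<n'}\Delta x_ih_i$ changes in one step by $-\Delta t$ times the difference of the $h$-fluxes at the interfaces $n'-\frac12$ and $m-\frac12$. (iv) *Semi-discrete energy inequality.* There is a numerical energy flux $\widetilde{\mathcal G}(q_l,q_r,b_l,b_r)$ with $\widetilde{\mathcal G}(q,q,b,b)=\widetilde G(q,b)$ such that, $\widetilde E'$ denoting the derivative of $\widetilde E$ in $q$ (which exists where $h>0$), for all states and $b_l,b_r$, with $\Delta b=b_r-b_l$, $$\widetilde G(q_r,b_r)+\widetilde E'(q_r,b_r)\bigl(F_r(q_l,q_r,\Delta b)-F(q_r)\bigr)\le\widetilde{\mathcal G}(q_l,q_r,b_l,b_r)\quad\text{if }h_r>0,$$ $$\widetilde{\mathcal G}(q_l,q_r,b_l,b_r)\le\widetilde G(q_l,b_l)+\widetilde E'(q_l,b_l)\bigl(F_l(q_l,q_r,\Delta b)-F(q_l)\bigr)\quad\text{if }h_l>0.$$ Moreover, at any time at which all cell values are states, in every cell with $h_i>0$ where $\frac{d}{dt}q_i=-\frac1{\Delta x_i}(F_l(q_i,q_{i+1},\Delta b_{i+1/2})-F_r(q_{i-1},q_i,\Delta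 b_{i-1/2}))$ holds, $\widetilde E(q_i,b_i)$ is differentiable in $t$ and $$\tfrac{d}{dt}\widetilde E(q_i,b_i)+\tfrac1{\Delta x_i}\bigl(\widetilde{\mathcal G}(q_i,q_{i+1},b_i,b_{i+1})-\widetilde{\mathcal G}(q_{i-1},q_i,b_{i-1},b_i)\bigr)\le0 .$$ (v) *Well-balancing.* If for all $i$ one has $u_i^n=0$, $h_i^n+b_i=C$ with a constant $C$, $\sigma_{xx,i}^n=\sigma_{zz,i}^n=1$, and $h_i^n\ge0$, then $q_i^{n+1}=q_i^n$ for all $i$. -/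

import Mathlib

open Filter Topology

noncomputable section

namespace ViscoSV

/-- Physical parameters: gravity `g`, polymer viscosity `etap` and relaxation time `lam`. -/
structure Params where
  g : ℝ
  etap : ℝ
  lam : ℝ
  g_pos : 0 < g
  etap_pos : 0 < etap
  lam_pos : 0 < lam

/-- A state, given by height, velocity and the two diagonal entries of the conformation tensor.
The velocity and the stresses are part of the data also where `h = 0`: this is how
the reconstructed states carry them. -/
@[ext] structure State where
  h : ℝ
  u : ℝ
  sxx : ℝ
  szz : ℝ

/-- Admissible states: nonnegative (possibly zero) height, positive stresses. -/
structure State.Admissible (W : State) : Prop where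
  h_nonneg : 0 ≤ W.h
  sxx_pos : 0 < W.sxx
  szz_pos : 0 < W.szz

/-- The pseudo-conservative variable `q = (h, h u, h σxx, h σzz)`. -/
def State.cons (W : State) : Fin 4 → ℝ := ![W.h, W.h * W.u, W.h * W.sxx, W.h * W.szz]

/-- The state with pseudo-conservative variable `q` (meaningful for `q 0 ≠ 0`). -/
def State.ofCons (q : Fin 4 → ℝ) : State := ⟨q 0, q 1 / q 0, q 2 / q 0, q 3 / q 0⟩

/-- Distance of two states. -/
def State.sep (V W : State) : ℝ :=
  |V.h - W.h| + |V.u - W.u| + |V.sxx - W.sxx| + |V.szz - W.szz|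

/-! The system: pressure, flux, energy, energy flux, source -/

/-- `P = g h² / 2 + (ηp / 2λ) h (σzz - σxx)`. -/
def pressure (p : Params) (W : State) : ℝ :=
  p.g * W.h ^ 2 / 2 + p.etap / (2 * p.lam) * (W.h * (W.szz - W.sxx))

/-- The pseudo-conservative flux `F(q) = (h u, h u² + P, h σxx u, h σzz u)`. -/
def flux (p : Params) (W : State) : Fin 4 → ℝ :=
  ![W.h * W.u, W.h * W.u ^ 2 + pressure p W, W.h * W.sxx * W.u, W.h * W.szz * W.u]

/-- The energy with topographic term, as a function of the state and of the bottom level. -/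
def energy (p : Params) (W : State) (b : ℝ) : ℝ :=
  W.h * W.u ^ 2 / 2 + p.g * W.h ^ 2 / 2 + p.g * W.h * b +
    p.etap / (4 * p.lam) * (W.h * (W.sxx + W.szz - Real.log (W.sxx * W.szz) - 2))

/-- The energy as a function of the pseudo-conservative variable `q`, at fixed bottom level. -/
def energyCons (p : Params) (b : ℝ) (q : Fin 4 → ℝ) : ℝ := energy p (State.ofCons q) b

/-- The energy flux with topography, `(Ẽ + P) u`. -/
def energyFlux (p : Params) (W : State) (b : ℝ) : ℝ := (energy p W b + pressure p W) * W.u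

/-- The terms of the system outside the flux divergence: topographic source and nonconservative
products, for a slope `bx` of the bottom and a velocity gradient `ux`. -/
def source (p : Params) (W : State) (bx ux : ℝ) : Fin 4 → ℝ :=
  ![0, -(p.g * W.h * bx), 2 * (W.h * W.sxx) * ux, -(2 * (W.h * W.szz) * ux)]

/-- Classical solutions (with positive height and stresses) on an open set `Ω` of points `(t, x)`
of the system with topography `b` and without relaxation source terms. -/
structure IsSmoothSolution (p : Params) (b : ℝ → ℝ) (Ω : Set (ℝ × ℝ)) (W : ℝ → ℝ → State) :
    Prop where
  isOpen : IsOpen Ω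
  contDiff_b : ContDiff ℝ 1 b
  contDiffOn_h : ContDiffOn ℝ 1 (fun z : ℝ × ℝ => (W z.1 z.2).h) Ω
  contDiffOn_u : ContDiffOn ℝ 1 (fun z : ℝ × ℝ => (W z.1 z.2).u) Ω
  contDiffOn_sxx : ContDiffOn ℝ 1 (fun z : ℝ × ℝ => (W z.1 z.2).sxx) Ω
  contDiffOn_szz : ContDiffOn ℝ 1 (fun z : ℝ × ℝ => (W z.1 z.2).szz) Ω
  h_pos : ∀ t x, (t, x) ∈ Ω → 0 < (W t x).h
  sxx_pos : ∀ t x, (t, x) ∈ Ω → 0 < (W t x).sxx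
  szz_pos : ∀ t x, (t, x) ∈ Ω → 0 < (W t x).szz
  eqn : ∀ t x, (t, x) ∈ Ω → ∀ k : Fin 4,
    deriv (fun s => (W s x).cons k) t + deriv (fun y => flux p (W t y) k) x =
      source p (W t x) (deriv b x) (deriv (fun y => (W t y).u) x) k

/-! The approximate Riemann solver without topography.

Only `L.h > 0` and `R.h > 0` avoid division by zero below. If exactly one height vanishes, the
convention `x / 0 = 0` yields height zero for the intermediate state of that side, which is the
limit of the formulas. If both vanish it yields zero fluxes. -/

/-- `a = √(∂P/∂h at fixed s)`. -/
def soundSpeed (p : Params) (W : State) : ℝ :=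
  √(p.g * W.h + p.etap / (2 * p.lam) * (3 * W.szz + W.sxx))

/-- The quotient `c_l / h_l`. -/
def ratioL (p : Params) (L R : State) : ℝ :=
  soundSpeed p L + 2 * (max 0 (L.u - R.u) +
    max 0 (pressure p R - pressure p L) / (L.h * soundSpeed p L + R.h * soundSpeed p R))

/-- The quotient `c_r / h_r`. -/
def ratioR (p : Params) (L R : State) : ℝ :=
  soundSpeed p R + 2 * (max 0 (L.u - R.u) +
    max 0 (pressure p L - pressure p R) / (L.h * soundSpeed p L + R.h * soundSpeed p R))

/-- The relaxation speed `c_l`. -/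
def cL (p : Params) (L R : State) : ℝ := L.h * ratioL p L R

/-- The relaxation speed `c_r`. -/
def cR (p : Params) (L R : State) : ℝ := R.h * ratioR p L R

/-- The intermediate velocity. -/
def uStar (p : Params) (L R : State) : ℝ :=
  (cL p L R * L.u + cR p L R * R.u + pressure p L - pressure p R) / (cL p L R + cR p L R)

/-- The intermediate relaxed pressure. -/
def piStar (p : Params) (L R : State) : ℝ :=
  (cR p L R * pressure p L + cL p L R * pressure p R - cL p L R * cR p L R * (R.u - L.u)) /
    (cL p L R + cR p L R)

/-- The left intermediate height. -/
def hStarL (p : Params) (L R : State) : ℝ :=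
  1 / (1 / L.h + (cR p L R * (R.u - L.u) + pressure p L - pressure p R) /
    (cL p L R * (cL p L R + cR p L R)))

/-- The right intermediate height. -/
def hStarR (p : Params) (L R : State) : ℝ :=
  1 / (1 / R.h + (cL p L R * (R.u - L.u) + pressure p R - pressure p L) /
    (cR p L R * (cL p L R + cR p L R)))

/-- The left intermediate state. -/
def starL (p : Params) (L R : State) : State :=
  ⟨hStarL p L R, uStar p L R, L.sxx * (L.h / hStarL p L R) ^ 2, L.szz * (hStarL p L R / L.h) ^ 2⟩

/-- The right intermediate state. -/
def starR (p : Params) (L R : State) : State :=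
  ⟨hStarR p L R, uStar p L R, R.sxx * (R.h / hStarR p L R) ^ 2, R.szz * (hStarR p L R / R.h) ^ 2⟩

/-- The first wave speed. -/
def speed1 (p : Params) (L R : State) : ℝ := L.u - ratioL p L R

/-- The second wave speed. -/
def speed2 (p : Params) (L R : State) : ℝ := uStar p L R

/-- The third wave speed. -/
def speed3 (p : Params) (L R : State) : ℝ := R.u + ratioR p L R

/-- The maximal propagation speed `A`. -/
def maxSpeed (p : Params) (L R : State) : ℝ :=
  max |speed1 p L R| (max |speed2 p L R| |speed3 p L R|)

/-- The state and the relaxed pressure of the Riemann solution at `x / t = 0`. -/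
def atZero (p : Params) (L R : State) : State × ℝ :=
  if 0 ≤ speed1 p L R then (L, pressure p L)
  else if 0 ≤ speed2 p L R then (starL p L R, piStar p L R)
  else if 0 ≤ speed3 p L R then (starR p L R, piStar p L R)
  else (R, pressure p R)

/-- The numerical flux of `h`. -/
def massFlux (p : Params) (L R : State) : ℝ := (atZero p L R).1.h * (atZero p L R).1.u

/-- The numerical flux of `h u`. -/
def momentumFlux (p : Params) (L R : State) : ℝ :=
  (atZero p L R).1.h * (atZero p L R).1.u ^ 2 + (atZero p L R).2

/-- The left numerical flux of a stress variable `f` (which is `h σxx` or `h σzz`). -/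
def stressFluxL (p : Params) (f : State → ℝ) (L R : State) : ℝ :=
  f L * L.u + min 0 (speed1 p L R) * (f (starL p L R) - f L) +
    min 0 (speed2 p L R) * (f (starR p L R) - f (starL p L R)) +
    min 0 (speed3 p L R) * (f R - f (starR p L R))

/-- The right numerical flux of a stress variable `f` (which is `h σxx` or `h σzz`). -/
def stressFluxR (p : Params) (f : State → ℝ) (L R : State) : ℝ :=
  f R * R.u - max 0 (speed1 p L R) * (f (starL p L R) - f L) -
    max 0 (speed2 p L R) * (f (starR p L R) - f (starL p L R)) -
    max 0 (speed3 p L R) * (f R - f (starR p L R))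

/-- The left numerical flux without topography. -/
def baseFluxL (p : Params) (L R : State) : Fin 4 → ℝ :=
  ![massFlux p L R, momentumFlux p L R,
    stressFluxL p (fun W => W.h * W.sxx) L R, stressFluxL p (fun W => W.h * W.szz) L R]

/-- The right numerical flux without topography. -/
def baseFluxR (p : Params) (L R : State) : Fin 4 → ℝ :=
  ![massFlux p L R, momentumFlux p L R,
    stressFluxR p (fun W => W.h * W.sxx) L R, stressFluxR p (fun W => W.h * W.szz) L R]

/-! The hydrostatic reconstruction and the scheme with topography -/

/-- The reconstructed left state for the bottom jump `db`. -/
def sharpL (L : State) (db : ℝ) : State := ⟨max 0 (L.h - max 0 db), L.u, L.sxx, L.szz⟩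

/-- The reconstructed right state for the bottom jump `db`. -/
def sharpR (R : State) (db : ℝ) : State := ⟨max 0 (R.h - max 0 (-db)), R.u, R.sxx, R.szz⟩

/-- The left numerical flux `F_l(q_l, q_r, Δb)`. -/
def fluxL (p : Params) (L R : State) (db : ℝ) : Fin 4 → ℝ :=
  baseFluxL p (sharpL L db) (sharpR R db) +
    ![0, p.g * L.h ^ 2 / 2 - p.g * (sharpL L db).h ^ 2 / 2, 0, 0]

/-- The right numerical flux `F_r(q_l, q_r, Δb)`. -/
def fluxR (p : Params) (L R : State) (db : ℝ) : Fin 4 → ℝ :=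
  baseFluxR p (sharpL L db) (sharpR R db) +
    ![0, p.g * R.h ^ 2 / 2 - p.g * (sharpR R db).h ^ 2 / 2, 0, 0]

/-- `F_l(q_i, q_{i+1}, Δb_{i+1/2}) - F_r(q_{i-1}, q_i, Δb_{i-1/2})`. -/
def fluxDiff (p : Params) (b : ℤ → ℝ) (W : ℤ → State) (i : ℤ) : Fin 4 → ℝ :=
  fluxL p (W i) (W (i + 1)) (b (i + 1) - b i) - fluxR p (W (i - 1)) (W i) (b i - b (i - 1))

/-- One time step: the value `q_i^{n+1}` in terms of the states at time `t_n`. -/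
def update (p : Params) (dx : ℤ → ℝ) (dt : ℝ) (b : ℤ → ℝ) (W : ℤ → State) (i : ℤ) : Fin 4 → ℝ :=
  (W i).cons - (dt / dx i) • fluxDiff p b W i

/-- The CFL condition at the interface between the cells `i` and `i + 1`. -/
def CFL (p : Params) (dx : ℤ → ℝ) (dt : ℝ) (b : ℤ → ℝ) (W : ℤ → State) (i : ℤ) : Prop :=
  dt * maxSpeed p (sharpL (W i) (b (i + 1) - b i)) (sharpR (W (i + 1)) (b (i + 1) - b i)) ≤
    1 / 2 * min (dx i) (dx (i + 1))

/-- Steady states at rest. -/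
def AtRest (b : ℤ → ℝ) (W : ℤ → State) : Prop :=
  ∃ C : ℝ, ∀ i, (W i).u = 0 ∧ (W i).h + b i = C ∧ (W i).sxx = 1 ∧ (W i).szz = 1

/-! The properties of the scheme -/

/-- Consistency with the system with topography: the numerical fluxes reduce to the exact flux,
continuously; their difference across an interface reproduces topographic source and
nonconservative products to first order; the truncation error along smooth solutions tends
to zero on uniform meshes. -/
structure Consistent (p : Params) : Prop where
  flux_eq : ∀ W : State, W.Admissible → fluxL p W W 0 = flux p W ∧ fluxR p W W 0 = flux p W
  flux_tendsto : ∀ W : State, W.Admissible → 0 < W.h → ∀ ε > 0, ∃ δ > 0, ∀ (L R : State) (db : ℝ),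
    L.sep W + R.sep W + |db| < δ → ∀ k : Fin 4,
      |fluxL p L R db k - flux p W k| < ε ∧ |fluxR p L R db k - flux p W k| < ε
  flux_jump : ∀ W : State, W.Admissible → 0 < W.h → ∀ ε > 0, ∃ δ > 0, ∀ (L R : State) (db : ℝ),
    L.sep W + R.sep W + |db| < δ → ∀ k : Fin 4,
      |fluxR p L R db k - fluxL p L R db k - source p W db (R.u - L.u) k| ≤
        ε * (L.sep R + |db|)
  truncation : ∀ (b : ℝ → ℝ) (Ω : Set (ℝ × ℝ)) (W : ℝ → ℝ → State), IsSmoothSolution p b Ω W →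
    ∀ t x, (t, x) ∈ Ω → ∀ k : Fin 4,
      Tendsto (fun d : ℝ × ℝ =>
        ((W (t + d.1) x).cons k - (W t x).cons k) / d.1 +
          (fluxL p (W t x) (W t (x + d.2)) (b (x + d.2) - b x) k -
            fluxR p (W t (x - d.2)) (W t x) (b x - b (x - d.2)) k) / d.2)
        (𝓝[>] 0 ×ˢ 𝓝[>] 0) (𝓝 0)

/-- Under the CFL condition, admissible data are updated to admissible data,
and positive heights stay positive. -/
def PositivityPreserving (p : Params) : Prop :=
  ∀ (dx : ℤ → ℝ) (dt : ℝ) (b : ℤ → ℝ) (W : ℤ → State),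
    (∀ i, 0 < dx i) → 0 < dt → (∀ i, (W i).Admissible) → (∀ i, CFL p dx dt b W i) →
    ∀ i, (∃ V : State, V.Admissible ∧ V.cons = update p dx dt b W i) ∧
      (0 < (W i).h → 0 < update p dx dt b W i 0 ∧ 0 < update p dx dt b W i 2 ∧
        0 < update p dx dt b W i 3)

/-- Conservativity in `h`: left and right fluxes of `h` agree, hence the mass in a range of cells
changes only through its two end interfaces. -/
structure ConservativeInHeight (p : Params) : Prop where
  flux_eq : ∀ (L R : State) (db : ℝ), fluxL p L R db 0 = fluxR p L R db 0
  mass_balance : ∀ (dx : ℤ → ℝ) (dt : ℝ) (b : ℤ → ℝ) (W : ℤ → State),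
    (∀ i, 0 < dx i) → ∀ m n : ℤ, m ≤ n →
      ∑ i ∈ Finset.Ico m n, dx i * update p dx dt b W i 0 =
        ∑ i ∈ Finset.Ico m n, dx i * (W i).h -
          dt * (fluxL p (W (n - 1)) (W n) (b n - b (n - 1)) 0 -
            fluxL p (W (m - 1)) (W m) (b m - b (m - 1)) 0)

/-- The semi-discrete energy inequality, with a numerical energy flux `Gn q_l q_r b_l b_r`:
consistency, the characterization at an interface (`fderiv` is the derivative of the energy with
respect to `q`, existing for positive height), and the resulting inequality along the scheme
with continuous time. -/
structure SemiDiscreteEnergy (p : Params) (Gn : State → State → ℝ → ℝ → ℝ) : Prop where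
  consistent : ∀ (W : State) (b : ℝ), W.Admissible → Gn W W b b = energyFlux p W b
  differentiable : ∀ (W : State) (b : ℝ), W.Admissible → 0 < W.h →
    DifferentiableAt ℝ (energyCons p b) W.cons
  right_le : ∀ (L R : State) (bl br : ℝ), L.Admissible → R.Admissible → 0 < R.h →
    energyFlux p R br +
      fderiv ℝ (energyCons p br) R.cons (fluxR p L R (br - bl) - flux p R) ≤ Gn L R bl br
  le_left : ∀ (L R : State) (bl br : ℝ), L.Admissible → R.Admissible → 0 < L.h →
    Gn L R bl br ≤ energyFlux p L bl +
      fderiv ℝ (energyCons p bl) L.cons (fluxL p L R (br - bl) - flux p L)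
  energy_decay : ∀ (dx : ℤ → ℝ) (b : ℤ → ℝ) (W : ℝ → ℤ → State) (t : ℝ) (i : ℤ),
    (∀ j, 0 < dx j) → (∀ j, (W t j).Admissible) → 0 < (W t i).h →
    HasDerivAt (fun s => (W s i).cons) (-((1 / dx i) • fluxDiff p b (W t) i)) t →
    ∃ D : ℝ, HasDerivAt (fun s => energy p (W s i) (b i)) D t ∧
      D + 1 / dx i * (Gn (W t i) (W t (i + 1)) (b i) (b (i + 1)) -
        Gn (W t (i - 1)) (W t i) (b (i - 1)) (b i)) ≤ 0

/-- Steady states at rest are preserved, for all meshes and time steps. -/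
def WellBalanced (p : Params) : Prop :=
  ∀ (dx : ℤ → ℝ) (dt : ℝ) (b : ℤ → ℝ) (W : ℤ → State),
    (∀ i, 0 < dx i) → 0 < dt → (∀ i, (W i).Admissible) → AtRest b W →
    ∀ i, update p dx dt b W i = (W i).cons

end ViscoSV

end

open Asymptotics Filter Topology

namespace ViscoSV

/-! ### The Riemann solver without topography: reflection symmetry, wave speeds, intermediate
states, fluxes as wave sums. -/

section Solver

variable {p : Params} {L R W : State}

/-! Everything rests on one representation. With `leftSum` and `rightSum` the jumps across the waves
of negative and positive speed, weighted by those speeds, every component of the solver satisfies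
`F_l = F(q_l) + leftSum` and `F_r = F(q_r) - rightSum` (`baseFluxL_eq`, `baseFluxR_eq`). For the
stresses this is the definition; for `h` and `hu` it is the Rankine-Hugoniot relation, which reduces
to `h_l^*(Σ₂ - Σ₁) = c_l` and `π_* = P_l - c_l (u_* - u_l)`. The reflection `x ↦ -x` exchanges the
two sums, so most estimates are proved on the left only.

Well-balancing: at rest both reconstructed states coincide, and the solver is exact on equal states.

Positivity: summation by parts writes `f_l (u_l + ν) - F_l` as a combination of values of `f` with
nonnegative weights once `ν` bounds the speeds. Half of the cell mass pays for each interface, and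
the reconstruction only lowers `f`. A dry cell has no mass to spend, but there each interface lets
either nothing or only inflow through.

Energy: `leftSum` is a nonpositive combination of differences from `q_l`, so convexity compares it
with the tangent of the energy at `q_l` (`leftSum_energy_le`), and symmetrically on the right. The
two sides are linked by dissipation across the fan (`energy_waves`), which comes down to a scalar
inequality in `y = h / h^*` (`relaxed_energy_aux`): the relaxation speed dominates the sound speed
even after compression. Topography leaves the defect `g m (h - h♯ - (Δb)₊)`, with `m` the outgoing
mass flux; it vanishes if the reconstructed state is wet and has the right sign otherwise, since
water cannot leave a dry state.

Consistency: each jump across an outer wave is a velocity jump times a factor converging at wet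
states (`starL_cons_sub`). Hence the wave sums vanish in the limit, and their first-order parts give
the nonconservative products. In the truncation error the wave sums at the two interfaces of a cell
have the same first-order limit and cancel. -/

lemma soundSpeed_pos (p : Params) (hW : W.Admissible) : 0 < soundSpeed p W := by
  have h1 := hW.h_nonneg
  have h2 := hW.sxx_pos
  have h3 := hW.szz_pos
  have := p.g_pos
  have := p.etap_pos
  have := p.lam_pos
  unfold soundSpeed
  positivity

lemma soundSpeed_sq (p : Params) (hW : W.Admissible) :
    soundSpeed p W ^ 2 = p.g * W.h + p.etap / (2 * p.lam) * (3 * W.szz + W.sxx) := by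
  have h1 := hW.h_nonneg
  have h2 := hW.sxx_pos
  have h3 := hW.szz_pos
  have := p.g_pos
  have := p.etap_pos
  have := p.lam_pos
  unfold soundSpeed
  exact Real.sq_sqrt (by positivity)

/-- The reflection `x ↦ -x`. -/
def State.mirror (W : State) : State := ⟨W.h, -W.u, W.sxx, W.szz⟩

@[simp] lemma State.mirror_h : W.mirror.h = W.h := rfl
@[simp] lemma State.mirror_u : W.mirror.u = -W.u := rfl
@[simp] lemma State.mirror_sxx : W.mirror.sxx = W.sxx := rfl
@[simp] lemma State.mirror_szz : W.mirror.szz = W.szz := rfl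
@[simp] lemma State.mirror_mirror : W.mirror.mirror = W := by ext <;> simp

lemma State.Admissible.mirror (hW : W.Admissible) : W.mirror.Admissible :=
  ⟨hW.h_nonneg, hW.sxx_pos, hW.szz_pos⟩

@[simp] lemma pressure_mirror : pressure p W.mirror = pressure p W := rfl
@[simp] lemma soundSpeed_mirror : soundSpeed p W.mirror = soundSpeed p W := rfl

-- The definitions of the two sides are exchanged by reflection together with swapping the states;
-- the following rules let every right-hand estimate be read off from its left-hand version.
@[simp] lemma ratioL_mirror : ratioL p R.mirror L.mirror = ratioR p L R := by
  simp only [ratioL, ratioR, soundSpeed_mirror, pressure_mirror, State.mirror_h, State.mirror_u]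
  rw [show -R.u - -L.u = L.u - R.u by ring,
    add_comm (R.h * soundSpeed p R)]

@[simp] lemma ratioR_mirror : ratioR p R.mirror L.mirror = ratioL p L R := by
  simpa using (ratioL_mirror (p := p) (L := R.mirror) (R := L.mirror)).symm

@[simp] lemma cL_mirror : cL p R.mirror L.mirror = cR p L R := by simp [cL, cR]
@[simp] lemma cR_mirror : cR p R.mirror L.mirror = cL p L R := by simp [cL, cR]

@[simp] lemma uStar_mirror : uStar p R.mirror L.mirror = -uStar p L R := by
  simp only [uStar, cL_mirror, cR_mirror, State.mirror_u, pressure_mirror]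
  rw [← neg_div, add_comm (cR p L R) (cL p L R)]
  ring

@[simp] lemma piStar_mirror : piStar p R.mirror L.mirror = piStar p L R := by
  simp only [piStar, cL_mirror, cR_mirror, State.mirror_u, pressure_mirror]
  rw [add_comm (cR p L R) (cL p L R)]
  ring

@[simp] lemma hStarL_mirror : hStarL p R.mirror L.mirror = hStarR p L R := by
  simp only [hStarL, hStarR, cL_mirror, cR_mirror, State.mirror_u, State.mirror_h,
    pressure_mirror]
  rw [add_comm (cR p L R) (cL p L R), show -L.u - -R.u = R.u - L.u by ring]

@[simp] lemma starL_mirror : starL p R.mirror L.mirror = (starR p L R).mirror := by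
  ext <;> simp [starL, starR]

@[simp] lemma hStarR_mirror : hStarR p R.mirror L.mirror = hStarL p L R := by
  simpa using (hStarL_mirror (p := p) (L := R.mirror) (R := L.mirror)).symm

@[simp] lemma starR_mirror : starR p R.mirror L.mirror = (starL p L R).mirror := by
  ext <;> simp [starL, starR]

@[simp] lemma speed1_mirror : speed1 p R.mirror L.mirror = -speed3 p L R := by
  simp [speed1, speed3]; ring
@[simp] lemma speed2_mirror : speed2 p R.mirror L.mirror = -speed2 p L R := by
  simp [speed2]
@[simp] lemma speed3_mirror : speed3 p R.mirror L.mirror = -speed1 p L R := by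
  simp [speed1, speed3]; ring

lemma maxSpeed_mirror : maxSpeed p R.mirror L.mirror = maxSpeed p L R := by
  simp only [maxSpeed, speed1_mirror, speed2_mirror, speed3_mirror, abs_neg]
  rw [max_comm |speed2 p L R|, max_left_comm, max_comm |speed2 p L R|, max_left_comm,
    max_comm |speed1 p L R| |speed2 p L R|, max_left_comm]

/-! Relaxation speeds -/

lemma weightedSpeeds_nonneg (p : Params) (hL : L.Admissible) (hR : R.Admissible) :
    0 ≤ L.h * soundSpeed p L + R.h * soundSpeed p R :=
  add_nonneg (mul_nonneg hL.h_nonneg (soundSpeed_pos p hL).le)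
    (mul_nonneg hR.h_nonneg (soundSpeed_pos p hR).le)

lemma soundSpeed_add_le_ratioL (p : Params) (hL : L.Admissible) (hR : R.Admissible) :
    soundSpeed p L + 2 * max 0 (L.u - R.u) ≤ ratioL p L R := by
  have : 0 ≤ max 0 (pressure p R - pressure p L) /
      (L.h * soundSpeed p L + R.h * soundSpeed p R) :=
    div_nonneg (le_max_left _ _) (weightedSpeeds_nonneg p hL hR)
  unfold ratioL
  linarith

lemma soundSpeed_le_ratioL (p : Params) (hL : L.Admissible) (hR : R.Admissible) :
    soundSpeed p L ≤ ratioL p L R := by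
  linarith [soundSpeed_add_le_ratioL p hL hR, le_max_left 0 (L.u - R.u)]

lemma soundSpeed_le_ratioR (p : Params) (hL : L.Admissible) (hR : R.Admissible) :
    soundSpeed p R ≤ ratioR p L R := by
  simpa using soundSpeed_le_ratioL p hR.mirror hL.mirror

lemma ratioL_pos (p : Params) (hL : L.Admissible) (hR : R.Admissible) : 0 < ratioL p L R :=
  (soundSpeed_pos p hL).trans_le (soundSpeed_le_ratioL p hL hR)

lemma ratioR_pos (p : Params) (hL : L.Admissible) (hR : R.Admissible) : 0 < ratioR p L R :=
  (soundSpeed_pos p hR).trans_le (soundSpeed_le_ratioR p hL hR)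

lemma cL_nonneg (p : Params) (hL : L.Admissible) (hR : R.Admissible) : 0 ≤ cL p L R :=
  mul_nonneg hL.h_nonneg (ratioL_pos p hL hR).le

lemma cR_nonneg (p : Params) (hL : L.Admissible) (hR : R.Admissible) : 0 ≤ cR p L R :=
  mul_nonneg hR.h_nonneg (ratioR_pos p hL hR).le

lemma cL_pos (p : Params) (hL : L.Admissible) (hR : R.Admissible) (h : 0 < L.h) :
    0 < cL p L R := mul_pos h (ratioL_pos p hL hR)

lemma cR_pos (p : Params) (hL : L.Admissible) (hR : R.Admissible) (h : 0 < R.h) :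
    0 < cR p L R := mul_pos h (ratioR_pos p hL hR)

lemma cL_add_cR_pos (p : Params) (hL : L.Admissible) (hR : R.Admissible) (h : 0 < L.h + R.h) :
    0 < cL p L R + cR p L R := by
  rcases hL.h_nonneg.eq_or_lt with h0 | h0
  · exact add_pos_of_nonneg_of_pos (cL_nonneg p hL hR) (cR_pos p hL hR (by linarith))
  · exact add_pos_of_pos_of_nonneg (cL_pos p hL hR h0) (cR_nonneg p hL hR)

lemma weightedSpeeds_pos (p : Params) (hL : L.Admissible) (hR : R.Admissible)
    (h : 0 < L.h + R.h) : 0 < L.h * soundSpeed p L + R.h * soundSpeed p R := by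
  rcases hL.h_nonneg.eq_or_lt with h0 | h0
  · exact add_pos_of_nonneg_of_pos (mul_nonneg hL.h_nonneg (soundSpeed_pos p hL).le)
      (mul_pos (by linarith) (soundSpeed_pos p hR))
  · exact add_pos_of_pos_of_nonneg (mul_pos h0 (soundSpeed_pos p hL))
      (mul_nonneg hR.h_nonneg (soundSpeed_pos p hR).le)

lemma weightedSpeeds_le (p : Params) (hL : L.Admissible) (hR : R.Admissible) :
    L.h * soundSpeed p L + R.h * soundSpeed p R ≤ cL p L R + cR p L R :=
  add_le_add (mul_le_mul_of_nonneg_left (soundSpeed_le_ratioL p hL hR) hL.h_nonneg)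
    (mul_le_mul_of_nonneg_left (soundSpeed_le_ratioR p hL hR) hR.h_nonneg)

lemma uStar_sub_left (p : Params) (h : cL p L R + cR p L R ≠ 0) :
    uStar p L R - L.u =
      (cR p L R * (R.u - L.u) + pressure p L - pressure p R) / (cL p L R + cR p L R) := by
  unfold uStar
  field_simp
  ring

lemma right_sub_uStar (p : Params) (h : cL p L R + cR p L R ≠ 0) :
    R.u - uStar p L R =
      (cL p L R * (R.u - L.u) + pressure p R - pressure p L) / (cL p L R + cR p L R) := by
  unfold uStar
  field_simp
  ring

/-- The factor 2 in `ratioL` is chosen for this bound: the excess of `ratioL` over the sound speed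
is twice the possible drop of velocity across the first wave. Half of the excess therefore survives
in `Σ₂ - Σ₁`, which is what both positivity of `hStarL` and the energy estimate need. -/
lemma uStar_sub_left_ge (p : Params) (hL : L.Admissible) (hR : R.Admissible)
    (h : 0 < L.h + R.h) : -((ratioL p L R - soundSpeed p L) / 2) ≤ uStar p L R - L.u := by
  have hS := cL_add_cR_pos p hL hR h
  have hN := weightedSpeeds_pos p hL hR h
  have hNS := weightedSpeeds_le p hL hR
  rw [uStar_sub_left p hS.ne', le_div_iff₀ hS]
  have hc := cL_nonneg p hL hR
  have hc' := cR_nonneg p hL hR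
  unfold ratioL
  set m := max 0 (L.u - R.u) with hm
  set k := max 0 (pressure p R - pressure p L) with hk
  have hm0 : 0 ≤ m := le_max_left _ _
  have hk0 : 0 ≤ k := le_max_left _ _
  have hm1 : L.u - R.u ≤ m := le_max_right _ _
  have hk1 : pressure p R - pressure p L ≤ k := le_max_right _ _
  have h1 : cR p L R * (L.u - R.u) ≤ cR p L R * m := mul_le_mul_of_nonneg_left hm1 hc'
  have h2 : 0 ≤ cL p L R * m := mul_nonneg hc hm0
  -- The quotient in `ratioL` is weighted with sound speeds instead of relaxation speeds, which
  -- avoids an implicit definition; as the former are smaller, it still absorbs the pressure jump.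
  have h3 : k ≤ k / (L.h * soundSpeed p L + R.h * soundSpeed p R) *
      (cL p L R + cR p L R) := by
    rw [div_mul_eq_mul_div, le_div_iff₀ hN]
    exact mul_le_mul_of_nonneg_left hNS hk0
  nlinarith

/-! Ordering of the wave speeds -/

lemma speed1_lt_left (p : Params) (hL : L.Admissible) (hR : R.Admissible) :
    speed1 p L R < L.u := by
  linarith [ratioL_pos p hL hR, show speed1 p L R = L.u - ratioL p L R from rfl]

/-- The term `2 (u_l - u_r)₊` in `ratioL` pushes the first wave below the velocity of the other side
as well. The reflected version confines `u_l` between the outer speeds, also for dry states. -/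
lemma speed1_lt_right (p : Params) (hL : L.Admissible) (hR : R.Admissible) :
    speed1 p L R < R.u := by
  linarith [soundSpeed_add_le_ratioL p hL hR, soundSpeed_pos p hL,
    show speed1 p L R = L.u - ratioL p L R from rfl, le_max_right 0 (L.u - R.u),
    le_max_left 0 (L.u - R.u)]

lemma left_lt_speed3 (p : Params) (hL : L.Admissible) (hR : R.Admissible) :
    L.u < speed3 p L R := by
  simpa using speed1_lt_right p hR.mirror hL.mirror

lemma speed1_lt_speed2 (p : Params) (hL : L.Admissible) (hR : R.Admissible)
    (h : 0 < L.h + R.h) : speed1 p L R < speed2 p L R := by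
  unfold speed1 speed2
  linarith [uStar_sub_left_ge p hL hR h, soundSpeed_pos p hL, soundSpeed_le_ratioL p hL hR]

lemma speed2_lt_speed3 (p : Params) (hL : L.Admissible) (hR : R.Admissible)
    (h : 0 < L.h + R.h) : speed2 p L R < speed3 p L R := by
  simpa using speed1_lt_speed2 p hR.mirror hL.mirror (by simpa [add_comm] using h)

/-! Intermediate heights -/

/-- Mass conservation across the first wave: fluid crosses it at the rate `c_l` on either side.
Positivity of the height thus becomes the ordering `Σ₁ < Σ₂`. -/
lemma hStarL_eq (p : Params) (hL : L.Admissible) (hR : R.Admissible) (h : 0 < L.h) :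
    hStarL p L R = cL p L R / (speed2 p L R - speed1 p L R) := by
  have hS := (cL_add_cR_pos p hL hR (by linarith [hR.h_nonneg])).ne'
  have hc := (cL_pos p hL hR h).ne'
  have key : 1 / L.h + (cR p L R * (R.u - L.u) + pressure p L - pressure p R) /
      (cL p L R * (cL p L R + cR p L R)) = (speed2 p L R - speed1 p L R) / cL p L R := by
    rw [show speed2 p L R - speed1 p L R = (uStar p L R - L.u) + ratioL p L R by
      unfold speed1 speed2; ring, uStar_sub_left p hS]
    have : 1 / L.h = ratioL p L R / cL p L R := by
      unfold cL
      have := (ratioL_pos p hL hR).ne'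
      field_simp
    rw [this]
    field_simp
    ring
  rw [hStarL, key, one_div_div]

lemma hStarL_pos (p : Params) (hL : L.Admissible) (hR : R.Admissible) (h : 0 < L.h) :
    0 < hStarL p L R := by
  rw [hStarL_eq p hL hR h]
  exact div_pos (cL_pos p hL hR h)
    (sub_pos.2 (speed1_lt_speed2 p hL hR (by linarith [hR.h_nonneg])))

lemma hStarL_of_dry (p : Params) (h : L.h = 0) : hStarL p L R = 0 := by
  simp [hStarL, cL, h]

lemma hStarR_of_dry (p : Params) (h : R.h = 0) : hStarR p L R = 0 := by
  simp [hStarR, cR, h]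

lemma hStarL_nonneg (p : Params) (hL : L.Admissible) (hR : R.Admissible) :
    0 ≤ hStarL p L R := by
  rcases hL.h_nonneg.eq_or_lt with h0 | h0
  · exact (hStarL_of_dry p h0.symm).ge
  · exact (hStarL_pos p hL hR h0).le

lemma hStarR_nonneg (p : Params) (hL : L.Admissible) (hR : R.Admissible) :
    0 ≤ hStarR p L R := by
  simpa using hStarL_nonneg p hR.mirror hL.mirror

/-- Written as a product the relation survives at a dry left state, where both sides are zero. -/
lemma hStarL_mul (p : Params) (hL : L.Admissible) (hR : R.Admissible) :
    hStarL p L R * (speed2 p L R - speed1 p L R) = cL p L R := by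
  rcases hL.h_nonneg.eq_or_lt with h0 | h0
  · simp [hStarL_of_dry p h0.symm, cL, h0.symm]
  · rw [hStarL_eq p hL hR h0, div_mul_cancel₀]
    exact (sub_pos.2 (speed1_lt_speed2 p hL hR (by linarith [hR.h_nonneg]))).ne'

lemma hStarR_mul (p : Params) (hL : L.Admissible) (hR : R.Admissible) :
    hStarR p L R * (speed3 p L R - speed2 p L R) = cR p L R := by
  have := hStarL_mul p hR.mirror hL.mirror
  simp only [hStarL_mirror, speed2_mirror, speed1_mirror, cL_mirror] at this
  rw [← this]
  ring

lemma left_mul (p : Params) : L.h * (L.u - speed1 p L R) = cL p L R := by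
  simp [cL, speed1]

lemma right_mul (p : Params) : R.h * (speed3 p L R - R.u) = cR p L R := by
  simp [cR, speed3]

lemma pressure_of_dry (p : Params) (h : W.h = 0) : pressure p W = 0 := by
  simp [pressure, h]

lemma piStar_eq_left (p : Params) (h : cL p L R + cR p L R ≠ 0) :
    piStar p L R = pressure p L - cL p L R * (uStar p L R - L.u) := by
  rw [uStar_sub_left p h, piStar]
  field_simp
  ring

lemma piStar_eq_right (p : Params) (h : cL p L R + cR p L R ≠ 0) :
    piStar p L R = pressure p R + cR p L R * (uStar p L R - R.u) := by
  have := right_sub_uStar p h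
  rw [show uStar p L R - R.u = -(R.u - uStar p L R) by ring, this, piStar]
  field_simp
  ring

/-! The fluxes as sums over the waves -/

/-- The waves of negative speed, weighted by their speeds. -/
noncomputable def leftSum (p : Params) (f : State → ℝ) (L R : State) : ℝ :=
  min 0 (speed1 p L R) * (f (starL p L R) - f L) +
    min 0 (speed2 p L R) * (f (starR p L R) - f (starL p L R)) +
    min 0 (speed3 p L R) * (f R - f (starR p L R))

/-- The waves of positive speed, weighted by their speeds. -/
noncomputable def rightSum (p : Params) (f : State → ℝ) (L R : State) : ℝ :=
  max 0 (speed1 p L R) * (f (starL p L R) - f L) +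
    max 0 (speed2 p L R) * (f (starR p L R) - f (starL p L R)) +
    max 0 (speed3 p L R) * (f R - f (starR p L R))

lemma leftSum_add_rightSum (p : Params) (f : State → ℝ) (L R : State) :
    leftSum p f L R + rightSum p f L R =
      speed1 p L R * (f (starL p L R) - f L) +
        speed2 p L R * (f (starR p L R) - f (starL p L R)) +
        speed3 p L R * (f R - f (starR p L R)) := by
  have h (a : ℝ) : max 0 a = a - min 0 a := by linarith [min_add_max 0 a]
  simp only [leftSum, rightSum, h]
  ring

lemma leftSum_mirror (p : Params) (f g : State → ℝ) (hfg : ∀ V : State, f V.mirror = g V) :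
    leftSum p f R.mirror L.mirror = rightSum p g L R := by
  have h (a : ℝ) : min 0 (-a) = -max 0 a := by
    rw [show (0 : ℝ) = -0 by simp, min_neg_neg]; simp
  simp only [leftSum, rightSum, speed1_mirror, speed2_mirror, speed3_mirror, starL_mirror,
    starR_mirror, hfg, h]
  ring

lemma stressFluxL_eq (p : Params) (f : State → ℝ) (L R : State) :
    stressFluxL p f L R = f L * L.u + leftSum p f L R := by
  simp only [stressFluxL, leftSum]; ring

lemma stressFluxR_eq (p : Params) (f : State → ℝ) (L R : State) :
    stressFluxR p f L R = f R * R.u - rightSum p f L R := by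
  simp only [stressFluxR, rightSum]; ring

lemma leftSum_of_dry (p : Params) (f : State → ℝ) (hf : ∀ V : State, V.h = 0 → f V = 0)
    (hL : L.h = 0) (hR : R.h = 0) : leftSum p f L R = 0 := by
  simp [leftSum, hf L hL, hf R hR, hf (starL p L R) (hStarL_of_dry p hL),
    hf (starR p L R) (hStarR_of_dry p hR)]

lemma rightSum_of_dry (p : Params) (f : State → ℝ) (hf : ∀ V : State, V.h = 0 → f V = 0)
    (hL : L.h = 0) (hR : R.h = 0) : rightSum p f L R = 0 := by
  simp [rightSum, hf L hL, hf R hR, hf (starL p L R) (hStarL_of_dry p hL),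
    hf (starR p L R) (hStarR_of_dry p hR)]

lemma atZero_of_dry (p : Params) (hL : L.h = 0) (hR : R.h = 0) :
    (atZero p L R).1.h = 0 ∧ (atZero p L R).2 = 0 := by
  unfold atZero
  split_ifs <;> simp [starL, starR, hL, hR, hStarL_of_dry, hStarR_of_dry, pressure_of_dry,
    piStar, cL, cR]

/-- The Rankine-Hugoniot relation for a flux given on the intermediate states. -/
lemma waves_of_jumps {s1 s2 s3 f0 f1 f2 f3 g0 g1 g2 g3 : ℝ} (h12 : s1 ≤ s2) (h23 : s2 ≤ s3)
    (j1 : g1 - g0 = s1 * (f1 - f0)) (j2 : g2 - g1 = s2 * (f2 - f1))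
    (j3 : g3 - g2 = s3 * (f3 - f2)) :
    (if 0 ≤ s1 then g0 else if 0 ≤ s2 then g1 else if 0 ≤ s3 then g2 else g3) =
      g0 + (min 0 s1 * (f1 - f0) + min 0 s2 * (f2 - f1) + min 0 s3 * (f3 - f2)) := by
  split_ifs with h1 h2 h3
  · simp [h1, h1.trans h12, (h1.trans h12).trans h23]
  · simp [(not_le.1 h1).le, h2, h2.trans h23]; linarith
  · simp [(not_le.1 h1).le, (not_le.1 h2).le, h3]; linarith
  · simp [(not_le.1 h1).le, (not_le.1 h2).le, (not_le.1 h3).le]; linarith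

lemma massFlux_eq (p : Params) (hL : L.Admissible) (hR : R.Admissible) :
    massFlux p L R = L.h * L.u + leftSum p State.h L R := by
  -- With both sides dry, `uStar` is `0 / 0 = 0` and the speeds need not be ordered, but every term
  -- carries a vanishing height. If one side is wet, the strict ordering holds and the general
  -- argument applies.
  rcases (add_nonneg hL.h_nonneg hR.h_nonneg).eq_or_lt with h0 | h0
  · have h1 : L.h = 0 := by linarith [hL.h_nonneg, hR.h_nonneg]
    have h2 : R.h = 0 := by linarith [hL.h_nonneg, hR.h_nonneg]
    rw [leftSum_of_dry p _ (fun _ h => h) h1 h2, massFlux, (atZero_of_dry p h1 h2).1, h1]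
    simp
  · have e1 := hStarL_mul p hL hR
    have e2 := hStarR_mul p hL hR
    have e3 := left_mul p (L := L) (R := R)
    have e4 := right_mul p (L := L) (R := R)
    have := waves_of_jumps (s1 := speed1 p L R) (s2 := speed2 p L R) (s3 := speed3 p L R)
      (f0 := L.h) (f1 := hStarL p L R) (f2 := hStarR p L R) (f3 := R.h)
      (g0 := L.h * L.u) (g1 := hStarL p L R * speed2 p L R)
      (g2 := hStarR p L R * speed2 p L R) (g3 := R.h * R.u)
      (speed1_lt_speed2 p hL hR h0).le (speed2_lt_speed3 p hL hR h0).le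
      (by linarith) (by ring) (by linarith)
    rw [leftSum]
    simp only [starL, starR]
    rw [← this, massFlux, atZero]
    split_ifs <;> simp [starL, starR, speed2]

lemma momentumFlux_eq (p : Params) (hL : L.Admissible) (hR : R.Admissible) :
    momentumFlux p L R = L.h * L.u ^ 2 + pressure p L +
      leftSum p (fun V => V.h * V.u) L R := by
  rcases (add_nonneg hL.h_nonneg hR.h_nonneg).eq_or_lt with h0 | h0
  · have h1 : L.h = 0 := by linarith [hL.h_nonneg, hR.h_nonneg]
    have h2 : R.h = 0 := by linarith [hL.h_nonneg, hR.h_nonneg]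
    rw [leftSum_of_dry p _ (fun _ h => by simp [h]) h1 h2, momentumFlux,
      (atZero_of_dry p h1 h2).1, (atZero_of_dry p h1 h2).2, h1, pressure_of_dry p h1]
    simp
  · have e1 := hStarL_mul p hL hR
    have e2 := hStarR_mul p hL hR
    have e3 := left_mul p (L := L) (R := R)
    have e4 := right_mul p (L := L) (R := R)
    have hS := (cL_add_cR_pos p hL hR h0).ne'
    have e5 := piStar_eq_left p hS
    have e6 := piStar_eq_right p hS
    have := waves_of_jumps (s1 := speed1 p L R) (s2 := speed2 p L R) (s3 := speed3 p L R)
      (f0 := L.h * L.u) (f1 := hStarL p L R * speed2 p L R)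
      (f2 := hStarR p L R * speed2 p L R) (f3 := R.h * R.u)
      (g0 := L.h * L.u ^ 2 + pressure p L)
      (g1 := hStarL p L R * speed2 p L R ^ 2 + piStar p L R)
      (g2 := hStarR p L R * speed2 p L R ^ 2 + piStar p L R)
      (g3 := R.h * R.u ^ 2 + pressure p R)
      (speed1_lt_speed2 p hL hR h0).le (speed2_lt_speed3 p hL hR h0).le
      (by change _ = cL p L R at e1
          have : uStar p L R = speed2 p L R := rfl
          rw [this] at e5
          linear_combination e5 + speed2 p L R * e1 - L.u * e3)
      (by ring)
      (by have : uStar p L R = speed2 p L R := rfl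
          rw [this] at e6
          linear_combination -e6 + speed2 p L R * e2 - R.u * e4)
    rw [leftSum]
    simp only [starL, starR]
    change _ = _ + (_ * (hStarL p L R * speed2 p L R - _) +
      _ * (hStarR p L R * speed2 p L R - hStarL p L R * speed2 p L R) +
      _ * (_ - hStarR p L R * speed2 p L R))
    rw [← this, momentumFlux, atZero]
    split_ifs <;> simp [starL, starR, speed2]

lemma baseFluxL_eq (p : Params) (hL : L.Admissible) (hR : R.Admissible) (k : Fin 4) :
    baseFluxL p L R k = flux p L k + leftSum p (fun V => V.cons k) L R := by
  fin_cases k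
  · simpa [baseFluxL, flux, State.cons] using massFlux_eq p hL hR
  · simpa [baseFluxL, flux, State.cons] using momentumFlux_eq p hL hR
  · simpa [baseFluxL, flux, State.cons] using stressFluxL_eq p (fun V => V.h * V.sxx) L R
  · simpa [baseFluxL, flux, State.cons] using stressFluxL_eq p (fun V => V.h * V.szz) L R

lemma mass_waves (p : Params) (hL : L.Admissible) (hR : R.Admissible) :
    leftSum p State.h L R + rightSum p State.h L R = R.h * R.u - L.h * L.u := by
  rw [leftSum_add_rightSum]
  have e1 := hStarL_mul p hL hR
  have e2 := hStarR_mul p hL hR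
  have e3 := left_mul p (L := L) (R := R)
  have e4 := right_mul p (L := L) (R := R)
  simp only [starL, starR]
  linear_combination e3 - e1 - e2 + e4

lemma momentum_waves (p : Params) (hL : L.Admissible) (hR : R.Admissible) :
    leftSum p (fun V => V.h * V.u) L R + rightSum p (fun V => V.h * V.u) L R =
      (R.h * R.u ^ 2 + pressure p R) - (L.h * L.u ^ 2 + pressure p L) := by
  rcases (add_nonneg hL.h_nonneg hR.h_nonneg).eq_or_lt with h0 | h0
  · have h1 : L.h = 0 := by linarith [hL.h_nonneg, hR.h_nonneg]
    have h2 : R.h = 0 := by linarith [hL.h_nonneg, hR.h_nonneg]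
    rw [leftSum_of_dry p _ (fun _ h => by simp [h]) h1 h2,
      rightSum_of_dry p _ (fun _ h => by simp [h]) h1 h2, pressure_of_dry p h1,
      pressure_of_dry p h2, h1, h2]
    simp
  · rw [leftSum_add_rightSum]
    have e1 := hStarL_mul p hL hR
    have e2 := hStarR_mul p hL hR
    have e3 := left_mul p (L := L) (R := R)
    have e4 := right_mul p (L := L) (R := R)
    have hS := (cL_add_cR_pos p hL hR h0).ne'
    have e5 := piStar_eq_left p hS
    have e6 := piStar_eq_right p hS
    have h2 : uStar p L R = speed2 p L R := rfl
    rw [h2] at e5 e6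
    simp only [starL, starR, h2]
    linear_combination L.u * e3 - speed2 p L R * e1 - speed2 p L R * e2 + R.u * e4 - e5 + e6

lemma baseFluxR_eq (p : Params) (hL : L.Admissible) (hR : R.Admissible) (k : Fin 4) :
    baseFluxR p L R k = flux p R k - rightSum p (fun V => V.cons k) L R := by
  fin_cases k
  · have h := massFlux_eq p hL hR
    have h' := mass_waves p hL hR
    simp only [baseFluxR, flux, State.cons, Fin.zero_eta, Matrix.cons_val_zero]
    linarith
  · have h := momentumFlux_eq p hL hR
    have h' := momentum_waves p hL hR
    simp only [baseFluxR, flux, State.cons, Fin.mk_one, Matrix.cons_val_one, Matrix.cons_val_zero]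
    linarith
  · simpa [baseFluxR, flux, State.cons] using stressFluxR_eq p (fun V => V.h * V.sxx) L R
  · simpa [baseFluxR, flux, State.cons] using stressFluxR_eq p (fun V => V.h * V.szz) L R

end Solver

/-! ### Equal states, well-balancing, and conservation of mass. -/

section Equal

variable {p : Params} {L R W : State}

lemma cons_of_dry (h : W.h = 0) (k : Fin 4) : W.cons k = 0 := by
  fin_cases k <;> simp [State.cons, h]

lemma starL_self (p : Params) (hW : W.Admissible) (h : 0 < W.h) : starL p W W = W := by
  have hc := cL_pos p hW hW h
  have hS := (cL_add_cR_pos p hW hW (by linarith)).ne'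
  have hu : uStar p W W = W.u := by
    have := uStar_sub_left p hS
    simp at this
    linarith
  have hh : hStarL p W W = W.h := by simp [hStarL]
  ext <;> simp [starL, hu, hh, h.ne']

lemma starR_self (p : Params) (hW : W.Admissible) (h : 0 < W.h) : starR p W W = W := by
  have := starL_self p hW.mirror h
  rw [starL_mirror] at this
  simpa using congrArg State.mirror this

lemma leftSum_self (p : Params) (f : State → ℝ) (hf : ∀ V : State, V.h = 0 → f V = 0)
    (hW : W.Admissible) : leftSum p f W W = 0 := by
  rcases hW.h_nonneg.eq_or_lt with h | h
  · exact leftSum_of_dry p f hf h.symm h.symm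
  · simp [leftSum, starL_self p hW h, starR_self p hW h]

lemma rightSum_self (p : Params) (f : State → ℝ) (hf : ∀ V : State, V.h = 0 → f V = 0)
    (hW : W.Admissible) : rightSum p f W W = 0 := by
  rcases hW.h_nonneg.eq_or_lt with h | h
  · exact rightSum_of_dry p f hf h.symm h.symm
  · simp [rightSum, starL_self p hW h, starR_self p hW h]

lemma baseFluxL_self (p : Params) (hW : W.Admissible) : baseFluxL p W W = flux p W := by
  ext k
  rw [baseFluxL_eq p hW hW, leftSum_self p _ (fun V h => cons_of_dry h k) hW, add_zero]

lemma baseFluxR_self (p : Params) (hW : W.Admissible) : baseFluxR p W W = flux p W := by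
  ext k
  rw [baseFluxR_eq p hW hW, rightSum_self p _ (fun V h => cons_of_dry h k) hW, sub_zero]

lemma sharpL_zero (hW : W.Admissible) : sharpL W 0 = W := by
  ext <;> simp [sharpL, hW.h_nonneg]

lemma sharpR_zero (hW : W.Admissible) : sharpR W 0 = W := by
  ext <;> simp [sharpR, hW.h_nonneg]

lemma sharpL_admissible (hL : L.Admissible) (db : ℝ) : (sharpL L db).Admissible :=
  ⟨le_max_left _ _, hL.sxx_pos, hL.szz_pos⟩

lemma sharpR_admissible (hR : R.Admissible) (db : ℝ) : (sharpR R db).Admissible :=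
  ⟨le_max_left _ _, hR.sxx_pos, hR.szz_pos⟩

lemma flux_consistent (p : Params) (hW : W.Admissible) :
    fluxL p W W 0 = flux p W ∧ fluxR p W W 0 = flux p W := by
  rw [fluxL, fluxR, sharpL_zero hW, sharpR_zero hW, baseFluxL_self p hW, baseFluxR_self p hW]
  constructor <;> ext k <;> fin_cases k <;> simp

/-- On a constant free surface both reconstructed heights are the smaller of the two heights. The
solver then returns the exact flux, whose hydrostatic pressure at the reconstructed height is
replaced by that of the cell, so the two interface fluxes of the cell agree. -/
lemma wellBalanced (p : Params) : WellBalanced p := by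
  intro dx dt b W hdx hdt hW ⟨C, hC⟩ i
  have key (i j : ℤ) : sharpL (W i) (b j - b i) = sharpR (W j) (b j - b i) := by
    obtain ⟨u1, e1, x1, z1⟩ := hC i
    obtain ⟨u2, e2, x2, z2⟩ := hC j
    have hb : b j - b i = (W i).h - (W j).h := by linarith
    have : (sharpL (W i) (b j - b i)).h = (sharpR (W j) (b j - b i)).h := by
      simp only [sharpL, sharpR, hb]
      congr 1
      rcases le_total (W i).h (W j).h with h | h
      · rw [max_eq_left (by linarith), max_eq_right (by linarith)]; ring
      · rw [max_eq_right (by linarith), max_eq_left (by linarith)]; ring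
    ext
    · exact this
    all_goals simp [sharpL, sharpR, u1, u2, x1, x2, z1, z2]
  have hflux (V : State) (hu : V.u = 0) (hx : V.sxx = 1) (hz : V.szz = 1) :
      flux p V = ![0, p.g * V.h ^ 2 / 2, 0, 0] := by
    ext k; fin_cases k <;> simp [flux, pressure, hu, hx, hz]
  have hl (i j : ℤ) : fluxL p (W i) (W j) (b j - b i) = ![0, p.g * (W i).h ^ 2 / 2, 0, 0] := by
    obtain ⟨u1, e1, x1, z1⟩ := hC i
    rw [fluxL, ← key, baseFluxL_self p (sharpL_admissible (hW i) _), hflux (sharpL _ _) u1 x1 z1]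
    ext k; fin_cases k <;> simp [sharpL]
  have hr (i j : ℤ) : fluxR p (W i) (W j) (b j - b i) = ![0, p.g * (W j).h ^ 2 / 2, 0, 0] := by
    obtain ⟨u1, e1, x1, z1⟩ := hC j
    rw [fluxR, key, baseFluxR_self p (sharpR_admissible (hW j) _), hflux (sharpR _ _) u1 x1 z1]
    ext k; fin_cases k <;> simp [sharpR]
  rw [update, fluxDiff, hl, hr]
  simp

lemma conservativeInHeight (p : Params) : ConservativeInHeight p := by
  have h0 (L R : State) (db : ℝ) : fluxL p L R db 0 = fluxR p L R db 0 := by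
    simp [fluxL, fluxR, baseFluxL, baseFluxR]
  refine ⟨h0, fun dx dt b W hdx m n hmn => ?_⟩
  induction n, hmn using Int.leInduction with
  | base => simp
  | succ n hmn ih =>
    have hI : Finset.Ico m (n + 1) = insert n (Finset.Ico m n) := by
      ext; simp; omega
    rw [hI, Finset.sum_insert (by simp), Finset.sum_insert (by simp), ih]
    have := (hdx n).ne'
    simp only [update, fluxDiff, Pi.sub_apply, Pi.smul_apply, smul_eq_mul, ← h0,
      add_sub_cancel_right]
    simp only [State.cons, Matrix.cons_val_zero]
    field_simp
    ring

end Equal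

/-! ### Positivity under the CFL condition, including dry cells. -/

section Positivity

variable {p : Params} {L R W : State} {f : State → ℝ} {ν : ℝ}

/-- A conserved quantity that is positive exactly on wet states. -/
structure WetPositive (f : State → ℝ) : Prop where
  dry : ∀ V : State, V.h = 0 → f V = 0
  pos : ∀ V : State, 0 < V.h → 0 < V.sxx → 0 < V.szz → 0 < f V
  mirror : ∀ V : State, f V.mirror = f V

lemma wetPositive_h : WetPositive State.h := ⟨fun _ h => h, fun _ h _ _ => h, fun _ => rfl⟩

lemma wetPositive_sxx : WetPositive (fun V => V.h * V.sxx) :=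
  ⟨fun V h => by simp [h], fun V h h' _ => mul_pos h h', fun _ => rfl⟩

lemma wetPositive_szz : WetPositive (fun V => V.h * V.szz) :=
  ⟨fun V h => by simp [h], fun V h _ h' => mul_pos h h', fun _ => rfl⟩

lemma WetPositive.nonneg (hf : WetPositive f) (hW : W.Admissible) : 0 ≤ f W := by
  rcases hW.h_nonneg.eq_or_lt with h | h
  · exact (hf.dry W h.symm).ge
  · exact (hf.pos W h hW.sxx_pos hW.szz_pos).le

lemma WetPositive.starL_pos (hf : WetPositive f) (p : Params) (hL : L.Admissible)
    (hR : R.Admissible) (h : 0 < L.h) : 0 < f (starL p L R) := by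
  have := hStarL_pos p hL hR h
  have := hL.sxx_pos
  have := hL.szz_pos
  apply hf.pos
  · simpa [starL]
  · simp only [starL]; positivity
  · simp only [starL]; positivity

lemma WetPositive.starR_pos (hf : WetPositive f) (p : Params) (hL : L.Admissible)
    (hR : R.Admissible) (h : 0 < R.h) : 0 < f (starR p L R) := by
  have := hf.starL_pos p hR.mirror hL.mirror h
  rwa [starL_mirror, hf.mirror] at this

lemma WetPositive.starL_nonneg (hf : WetPositive f) (p : Params) (hL : L.Admissible)
    (hR : R.Admissible) : 0 ≤ f (starL p L R) := by
  rcases hL.h_nonneg.eq_or_lt with h | h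
  · exact (hf.dry _ (hStarL_of_dry p h.symm)).ge
  · exact (hf.starL_pos p hL hR h).le

lemma WetPositive.starR_nonneg (hf : WetPositive f) (p : Params) (hL : L.Admissible)
    (hR : R.Admissible) : 0 ≤ f (starR p L R) := by
  have := hf.starL_nonneg p hR.mirror hL.mirror
  rwa [starL_mirror, hf.mirror] at this

/-- The left flux of a positive quantity. -/
noncomputable def leftFlux (p : Params) (f : State → ℝ) (L R : State) : ℝ :=
  f L * L.u + leftSum p f L R

/-- The right flux of a positive quantity. -/
noncomputable def rightFlux (p : Params) (f : State → ℝ) (L R : State) : ℝ :=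
  f R * R.u - rightSum p f L R

lemma leftFlux_mirror (hf : WetPositive f) :
    leftFlux p f R.mirror L.mirror = -rightFlux p f L R := by
  rw [leftFlux, rightFlux, leftSum_mirror p f f hf.mirror, hf.mirror, State.mirror_u]
  ring

/-- The velocity lies strictly between the first and third speeds, so the CFL bound also controls
advection by the cell itself. -/
lemma abs_left_lt_maxSpeed (p : Params) (hL : L.Admissible) (hR : R.Admissible) :
    |L.u| < maxSpeed p L R := by
  have h1 := speed1_lt_left p hL hR
  have h3 := left_lt_speed3 p hL hR
  have a1 : |speed1 p L R| ≤ maxSpeed p L R := le_max_left _ _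
  have a3 : |speed3 p L R| ≤ maxSpeed p L R := (le_max_right _ _).trans (le_max_right _ _)
  rw [abs_lt]
  constructor
  · linarith [neg_abs_le (speed1 p L R)]
  · linarith [le_abs_self (speed3 p L R)]

/-- The part of the left flux that does not come from the left state is nonpositive. -/
lemma leftFlux_le (hf : WetPositive f) (hL : L.Admissible) (hR : R.Admissible)
    (hν : maxSpeed p L R ≤ ν) :
    leftFlux p f L R ≤ f L * (L.u + ν) ∧ (0 < L.h → leftFlux p f L R < f L * (L.u + ν)) := by
  have hν0 : 0 < ν := ((abs_nonneg _).trans_lt (abs_left_lt_maxSpeed p hL hR)).trans_le hν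
  rcases (add_nonneg hL.h_nonneg hR.h_nonneg).eq_or_lt with h0 | h0
  · have h1 : L.h = 0 := by linarith [hL.h_nonneg, hR.h_nonneg]
    have h2 : R.h = 0 := by linarith [hL.h_nonneg, hR.h_nonneg]
    simp [leftFlux, leftSum_of_dry p f hf.dry h1 h2, hf.dry L h1, h1]
  · have h12 := speed1_lt_speed2 p hL hR h0
    have h23 := speed2_lt_speed3 p hL hR h0
    have hs1 : -ν ≤ speed1 p L R :=
      (neg_le_neg ((le_max_left _ _).trans hν)).trans (neg_abs_le _)
    -- Summation by parts over the waves. Since `min 0` is monotone and the speeds are ordered, all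
    -- four weights are nonnegative.
    have e : f L * (L.u + ν) - leftFlux p f L R =
        f L * (ν + min 0 (speed1 p L R)) +
          f (starL p L R) * (min 0 (speed2 p L R) - min 0 (speed1 p L R)) +
          f (starR p L R) * (min 0 (speed3 p L R) - min 0 (speed2 p L R)) +
          f R * -min 0 (speed3 p L R) := by
      simp only [leftFlux, leftSum]; ring
    have n1 : 0 ≤ ν + min 0 (speed1 p L R) := by
      rcases min_choice 0 (speed1 p L R) with h | h <;> rw [h] <;> linarith
    have n2 : 0 ≤ min 0 (speed2 p L R) - min 0 (speed1 p L R) :=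
      sub_nonneg.2 (min_le_min_left _ h12.le)
    have n3 : 0 ≤ min 0 (speed3 p L R) - min 0 (speed2 p L R) :=
      sub_nonneg.2 (min_le_min_left _ h23.le)
    have n4 : 0 ≤ -min 0 (speed3 p L R) := neg_nonneg.2 (min_le_left _ _)
    have t1 := mul_nonneg (hf.nonneg hL) n1
    have t2 := mul_nonneg (hf.starL_nonneg p hL hR) n2
    have t3 := mul_nonneg (hf.starR_nonneg p hL hR) n3
    have t4 := mul_nonneg (hf.nonneg hR) n4
    refine ⟨by linarith, fun h => ?_⟩
    have fL := hf.pos L h hL.sxx_pos hL.szz_pos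
    -- If the weight of `f L` degenerates, the first wave has speed `-ν < 0`; then the weight of the
    -- left intermediate state, which is wet, is positive.
    rcases n1.eq_or_lt with h1 | h1
    · have hneg : speed1 p L R < 0 := by
        by_contra hc
        rw [min_eq_left (not_lt.1 hc)] at h1
        linarith
      have : 0 < min 0 (speed2 p L R) - min 0 (speed1 p L R) := by
        rw [min_eq_right hneg.le]
        exact sub_pos.2 (lt_min hneg h12)
      linarith [mul_pos (hf.starL_pos p hL hR h) this]
    · linarith [mul_pos fL h1]

lemma rightFlux_ge (hf : WetPositive f) (hL : L.Admissible) (hR : R.Admissible)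
    (hν : maxSpeed p L R ≤ ν) :
    f R * (R.u - ν) ≤ rightFlux p f L R ∧ (0 < R.h → f R * (R.u - ν) < rightFlux p f L R) := by
  have := leftFlux_le hf hR.mirror hL.mirror (maxSpeed_mirror.trans_le hν)
  rw [leftFlux_mirror hf, hf.mirror, State.mirror_u, State.mirror_h] at this
  exact ⟨by linarith [this.1], fun h => by linarith [this.2 h]⟩

lemma leftFlux_nonpos_of_dry (p : Params) (hf : WetPositive f) (hL : L.Admissible)
    (hR : R.Admissible) (h : L.h = 0) : leftFlux p f L R ≤ 0 := by
  simpa [hf.dry L h] using (leftFlux_le hf hL hR le_rfl).1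

lemma rightFlux_nonneg_of_dry (p : Params) (hf : WetPositive f) (hL : L.Admissible)
    (hR : R.Admissible) (h : R.h = 0) : 0 ≤ rightFlux p f L R := by
  simpa [hf.dry R h] using (rightFlux_ge hf hL hR le_rfl).1

/-- Next to a dry cell, either nothing flows or all positive quantities flow in. -/
lemma leftFlux_neg_of_dry (p : Params) (hL : L.Admissible) (hR : R.Admissible) (h : L.h = 0) :
    (∀ f, WetPositive f → leftFlux p f L R < 0) ∨
      ∀ f, (∀ V : State, V.h = 0 → f V = 0) → f L * L.u + leftSum p f L R = 0 := by
  rcases hR.h_nonneg.eq_or_lt with hR0 | hR0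
  · exact .inr fun f hf => by simp [leftSum_of_dry p f hf h hR0.symm, hf L h]
  have h0 : 0 < L.h + R.h := by linarith
  have h23 := speed2_lt_speed3 p hL hR h0
  -- The left intermediate state is dry too, so the first wave carries no jump. The sign of the
  -- second speed decides for all `f` at once, momentum included, whether anything crosses.
  rcases le_or_gt 0 (speed2 p L R) with h2 | h2
  · right
    intro f hf
    simp [leftSum, hf L h, hf (starL p L R) (hStarL_of_dry p h), h2, h2.trans h23.le]
  · left
    intro f hf
    have e : leftFlux p f L R =
        f (starR p L R) * (min 0 (speed2 p L R) - min 0 (speed3 p L R)) +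
          f R * min 0 (speed3 p L R) := by
      simp only [leftFlux, leftSum, hf.dry L h, hf.dry (starL p L R) (hStarL_of_dry p h)]; ring
    have n3 : min 0 (speed2 p L R) - min 0 (speed3 p L R) < 0 := by
      rw [min_eq_right h2.le]
      exact sub_neg.2 (lt_min h2 h23)
    have n4 : min 0 (speed3 p L R) ≤ 0 := min_le_left _ _
    rw [e]
    have := mul_neg_of_pos_of_neg (hf.starR_pos p hL hR hR0) n3
    have := mul_nonpos_of_nonneg_of_nonpos (hf.nonneg hR) n4
    linarith

lemma rightFlux_pos_of_dry (p : Params) (hL : L.Admissible) (hR : R.Admissible) (h : R.h = 0) :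
    (∀ f, WetPositive f → 0 < rightFlux p f L R) ∨
      ∀ f, (∀ V : State, V.h = 0 → f V = 0) → f R * R.u - rightSum p f L R = 0 := by
  refine (leftFlux_neg_of_dry p hR.mirror hL.mirror h).imp (fun H f hf => ?_) fun H f hf => ?_
  · have := H f hf
    rw [leftFlux_mirror hf] at this
    linarith
  -- The reflected quantity is used because `f` may be the momentum, which changes sign.
  · have := H (fun V => f V.mirror) fun V hV => hf _ hV
    rw [leftSum_mirror p _ f (fun V => by simp)] at this
    simp only [State.mirror_mirror, State.mirror_u] at this
    linarith

lemma WetPositive.sharpL_le (hf : WetPositive f) (hW : W.Admissible)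
    (hlin : ∀ V : State, f V = V.h * f ⟨1, V.u, V.sxx, V.szz⟩) (db : ℝ) :
    f (sharpL W db) ≤ f W := by
  rw [hlin W, hlin (sharpL W db)]
  refine mul_le_mul_of_nonneg_right ?_
    (hf.pos ⟨1, W.u, W.sxx, W.szz⟩ one_pos hW.sxx_pos hW.szz_pos).le
  exact max_le hW.h_nonneg (by linarith [le_max_left 0 db])

lemma WetPositive.sharpR_le (hf : WetPositive f) (hW : W.Admissible)
    (hlin : ∀ V : State, f V = V.h * f ⟨1, V.u, V.sxx, V.szz⟩) (db : ℝ) :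
    f (sharpR W db) ≤ f W := by
  rw [hlin W, hlin (sharpR W db)]
  refine mul_le_mul_of_nonneg_right ?_
    (hf.pos ⟨1, W.u, W.sxx, W.szz⟩ one_pos hW.sxx_pos hW.szz_pos).le
  exact max_le hW.h_nonneg (by linarith [le_max_left 0 (-db)])

/-- Positivity of the update of one cell between two interfaces. -/
lemma cell_update_pos (hf : WetPositive f) (hW : W.Admissible)
    (hlin : ∀ V : State, f V = V.h * f ⟨1, V.u, V.sxx, V.szz⟩)
    (hL : L.Admissible) (hR : R.Admissible) {db db' : ℝ}
    (hν : maxSpeed p (sharpL W db) R ≤ ν) (hν' : maxSpeed p L (sharpR W db') ≤ ν)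
    (h : 0 < W.h) :
    0 < 2 * ν * f W - (leftFlux p f (sharpL W db) R - rightFlux p f L (sharpR W db')) := by
  have hW1 := sharpL_admissible hW db
  have hW2 := sharpR_admissible hW db'
  have f1 := leftFlux_le hf hW1 hR hν
  have f2 := rightFlux_ge hf hL hW2 hν'
  have hu := (abs_left_lt_maxSpeed p hW1 hR).trans_le hν
  rw [abs_lt] at hu
  have e1 : (sharpL W db).u = W.u := rfl
  have e2 : (sharpR W db').u = W.u := rfl
  rw [e1] at f1 hu
  rw [e2] at f2
  have g2 : f W * (W.u - ν) ≤ f (sharpR W db') * (W.u - ν) :=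
    mul_le_mul_of_nonpos_right (hf.sharpR_le hW hlin _) (by linarith)
  -- If the reconstruction has dried out the left trace, strictness comes from the mass removed by
  -- it, as `u + ν > 0`; otherwise from the strict flux bound.
  rcases hW1.h_nonneg.eq_or_lt with h0 | h0
  · have fW := hf.pos W h hW.sxx_pos hW.szz_pos
    have g1 : 0 < f W * (W.u + ν) := mul_pos fW (by linarith)
    have := f1.1
    rw [hf.dry _ h0.symm, zero_mul] at this
    linarith [f2.1]
  · have g1 : f (sharpL W db) * (W.u + ν) ≤ f W * (W.u + ν) :=
      mul_le_mul_of_nonneg_right (hf.sharpL_le hW hlin _) (by linarith)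
    linarith [f1.2 h0, f2.1]

lemma fluxL_apply (p : Params) (hL : L.Admissible) (hR : R.Admissible) (db : ℝ) :
    fluxL p L R db 0 = leftFlux p State.h (sharpL L db) (sharpR R db) ∧
    fluxL p L R db 1 = (sharpL L db).h * (sharpL L db).u ^ 2 + pressure p (sharpL L db) +
      leftSum p (fun V => V.h * V.u) (sharpL L db) (sharpR R db) +
      (p.g * L.h ^ 2 / 2 - p.g * (sharpL L db).h ^ 2 / 2) ∧
    fluxL p L R db 2 = leftFlux p (fun V => V.h * V.sxx) (sharpL L db) (sharpR R db) ∧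
    fluxL p L R db 3 = leftFlux p (fun V => V.h * V.szz) (sharpL L db) (sharpR R db) := by
  have e := baseFluxL_eq p (sharpL_admissible hL db) (sharpR_admissible hR db)
  refine ⟨?_, ?_, ?_, ?_⟩ <;> rw [fluxL, Pi.add_apply, e] <;> simp [flux, State.cons, leftFlux]

lemma fluxR_apply (p : Params) (hL : L.Admissible) (hR : R.Admissible) (db : ℝ) :
    fluxR p L R db 0 = rightFlux p State.h (sharpL L db) (sharpR R db) ∧
    fluxR p L R db 1 = (sharpR R db).h * (sharpR R db).u ^ 2 + pressure p (sharpR R db) -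
      rightSum p (fun V => V.h * V.u) (sharpL L db) (sharpR R db) +
      (p.g * R.h ^ 2 / 2 - p.g * (sharpR R db).h ^ 2 / 2) ∧
    fluxR p L R db 2 = rightFlux p (fun V => V.h * V.sxx) (sharpL L db) (sharpR R db) ∧
    fluxR p L R db 3 = rightFlux p (fun V => V.h * V.szz) (sharpL L db) (sharpR R db) := by
  have e := baseFluxR_eq p (sharpL_admissible hL db) (sharpR_admissible hR db)
  refine ⟨?_, ?_, ?_, ?_⟩ <;> rw [fluxR, Pi.add_apply, e] <;> simp [flux, State.cons, rightFlux]

lemma exists_state_of_pos {q : Fin 4 → ℝ} (h0 : 0 < q 0) (h2 : 0 < q 2) (h3 : 0 < q 3) :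
    ∃ V : State, V.Admissible ∧ V.cons = q := by
  refine ⟨State.ofCons q, ⟨h0.le, div_pos h2 h0, div_pos h3 h0⟩, ?_⟩
  have := h0.ne'
  ext k
  fin_cases k <;> simp [State.cons, State.ofCons] <;> field_simp

lemma sharpL_of_dry (hW : W.h = 0) (db : ℝ) : (sharpL W db).h = 0 := by
  simp [sharpL, hW]

lemma sharpR_of_dry (hW : W.h = 0) (db : ℝ) : (sharpR W db).h = 0 := by
  simp [sharpR, hW]

lemma positivityPreserving (p : Params) : PositivityPreserving p := by
  intro dx dt b W hdx hdt hW hcfl i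
  set db := b (i + 1) - b i with hdb
  set db' := b i - b (i - 1) with hdb'
  have hr : 0 < dt / dx i := div_pos hdt (hdx i)
  -- The largest speed allowed by the CFL condition: `2 ν dt / dx = 1` splits the content of the
  -- cell into one half for each interface.
  set ν := dx i / (2 * dt) with hν
  have hrν : dt / dx i * (2 * ν) = 1 := by
    have := (hdx i).ne'
    rw [hν]; field_simp
  have c1 : maxSpeed p (sharpL (W i) db) (sharpR (W (i + 1)) db) ≤ ν := by
    rw [hν, le_div_iff₀ (by positivity)]
    have := hcfl i
    unfold CFL at this
    linarith [min_le_left (dx i) (dx (i + 1))]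
  have c2 : maxSpeed p (sharpL (W (i - 1)) db') (sharpR (W i) db') ≤ ν := by
    rw [hν, le_div_iff₀ (by positivity)]
    have := hcfl (i - 1)
    unfold CFL at this
    rw [sub_add_cancel] at this
    linarith [min_le_right (dx (i - 1)) (dx i)]
  obtain ⟨l0, l1, l2, l3⟩ := fluxL_apply p (hW i) (hW (i + 1)) db
  obtain ⟨r0, r1, r2, r3⟩ := fluxR_apply p (hW (i - 1)) (hW i) db'
  have hu (k : Fin 4) : update p dx dt b W i k = (W i).cons k -
      dt / dx i * (fluxL p (W i) (W (i + 1)) db k - fluxR p (W (i - 1)) (W i) db' k) := rfl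
  have aL := sharpL_admissible (hW (i - 1)) db'
  have aR := sharpR_admissible (hW (i + 1)) db
  have aL' := sharpL_admissible (hW i) db
  have aR' := sharpR_admissible (hW i) db'
  rcases (hW i).h_nonneg.eq_or_lt with h | h
  -- A dry cell: if one interface has strict inflow, the other cannot undo it, and all three
  -- positive quantities become positive; otherwise all four components stay zero, so that a
  -- vanishing height does not come with leftover momentum or stress.
  · refine ⟨?_, fun h' => absurd h h'.ne⟩
    have d1 := sharpL_of_dry h.symm db
    have d2 := sharpR_of_dry h.symm db'
    have hc := cons_of_dry h.symm
    have strict (H : ∀ f, WetPositive f →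
        leftFlux p f (sharpL (W i) db) (sharpR (W (i + 1)) db) -
          rightFlux p f (sharpL (W (i - 1)) db') (sharpR (W i) db') < 0) :
        ∃ V : State, V.Admissible ∧ V.cons = update p dx dt b W i := by
      apply exists_state_of_pos
      · rw [hu, hc, l0, r0]
        linarith [mul_neg_of_pos_of_neg hr (H _ wetPositive_h)]
      · rw [hu, hc, l2, r2]
        linarith [mul_neg_of_pos_of_neg hr (H _ wetPositive_sxx)]
      · rw [hu, hc, l3, r3]
        linarith [mul_neg_of_pos_of_neg hr (H _ wetPositive_szz)]
    rcases leftFlux_neg_of_dry p aL' aR d1 with H1 | H1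
    · exact strict fun f hf => by
        linarith [H1 f hf, rightFlux_nonneg_of_dry p hf aL aR' d2]
    rcases rightFlux_pos_of_dry p aL aR' d2 with H2 | H2
    · exact strict fun f hf => by
        linarith [H2 f hf, leftFlux_nonpos_of_dry p hf aL' aR d1]
    -- Velocity and stresses are arbitrary at zero height, so any positive stresses serve.
    refine ⟨⟨0, 0, 1, 1⟩, ⟨le_rfl, one_pos, one_pos⟩, ?_⟩
    have m1 := H1 (fun V => V.h * V.u) fun V hV => by simp [hV]
    have m2 := H2 (fun V => V.h * V.u) fun V hV => by simp [hV]
    rw [d1, zero_mul, zero_mul, zero_add] at m1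
    rw [d2, zero_mul, zero_mul, zero_sub, neg_eq_zero] at m2
    ext k
    rw [hu, hc, cons_of_dry rfl]
    fin_cases k
    · simp only [Fin.zero_eta]
      rw [l0, r0, leftFlux, rightFlux, H1 _ wetPositive_h.dry, H2 _ wetPositive_h.dry]; simp
    · simp only [Fin.mk_one]
      rw [l1, r1, m1, m2, d1, d2, pressure_of_dry p d1, pressure_of_dry p d2, ← h]; simp
    · simp only [Fin.reduceFinMk]
      rw [l2, r2, leftFlux, rightFlux, H1 _ wetPositive_sxx.dry, H2 _ wetPositive_sxx.dry]; simp
    · simp only [Fin.reduceFinMk]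
      rw [l3, r3, leftFlux, rightFlux, H1 _ wetPositive_szz.dry, H2 _ wetPositive_szz.dry]; simp
  · have key {f : State → ℝ} (hf : WetPositive f)
        (hlin : ∀ V : State, f V = V.h * f ⟨1, V.u, V.sxx, V.szz⟩) :
        0 < f (W i) - dt / dx i * (leftFlux p f (sharpL (W i) db) (sharpR (W (i + 1)) db) -
          rightFlux p f (sharpL (W (i - 1)) db') (sharpR (W i) db')) := by
      have := mul_pos hr (cell_update_pos hf (hW i) hlin aL aR c1 c2 h)
      rw [mul_sub, ← mul_assoc, hrν, one_mul] at this
      exact this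
    have k0 : 0 < update p dx dt b W i 0 := by
      rw [hu, l0, r0]
      exact key wetPositive_h fun V => by simp
    have k2 : 0 < update p dx dt b W i 2 := by
      rw [hu, l2, r2]
      exact key wetPositive_sxx fun V => by simp
    have k3 : 0 < update p dx dt b W i 3 := by
      rw [hu, l3, r3]
      exact key wetPositive_szz fun V => by simp
    exact ⟨exists_state_of_pos k0 k2 k3, fun _ => ⟨k0, k2, k3⟩⟩

end Positivity

/-! ### The semi-discrete energy inequality. -/

section Energy

variable {p : Params} {L R V W : State} {b : ℝ}

/-- The derivative of the energy in the pseudo-conservative variable; the formula also makes sense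
for `h = 0`. -/
noncomputable def energyGrad (p : Params) (W : State) (b : ℝ) (q : Fin 4 → ℝ) : ℝ :=
  (-(W.u ^ 2 / 2) + p.g * W.h + p.g * b -
      p.etap / (4 * p.lam) * Real.log (W.sxx * W.szz)) * q 0 + W.u * q 1 +
    p.etap / (4 * p.lam) * (1 - 1 / W.sxx) * q 2 + p.etap / (4 * p.lam) * (1 - 1 / W.szz) * q 3

lemma ofCons_cons (h : W.h ≠ 0) : State.ofCons W.cons = W := by
  ext <;> simp [State.ofCons, State.cons, h]

lemma energyCons_differentiableAt (p : Params) (b : ℝ) (hW : W.Admissible) (h : 0 < W.h) :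
    DifferentiableAt ℝ (energyCons p b) W.cons := by
  have h0 : W.cons 0 ≠ 0 := h.ne'
  have hx : W.cons 2 / W.cons 0 * (W.cons 3 / W.cons 0) ≠ 0 := by
    have := hW.sxx_pos.ne'
    have := hW.szz_pos.ne'
    simp [State.cons, h.ne', *]
  unfold energyCons energy State.ofCons
  simp only
  fun_prop (disch := assumption)

lemma fderiv_energyCons (p : Params) (b : ℝ) (hW : W.Admissible) (h : 0 < W.h)
    (q : Fin 4 → ℝ) : fderiv ℝ (energyCons p b) W.cons q = energyGrad p W b q := by
  have hd := (energyCons_differentiableAt p b hW h).hasFDerivAt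
  -- The gradient is identified through its directional derivatives, by differentiating the explicit
  -- energy along a line and using uniqueness of the derivative.
  have hline : HasDerivAt (fun s : ℝ => W.cons + s • q) q 0 := by
    simpa using ((hasDerivAt_id (0 : ℝ)).smul_const q).const_add W.cons
  have h1 : HasDerivAt (fun s : ℝ => energyCons p b (W.cons + s • q))
      (fderiv ℝ (energyCons p b) W.cons q) 0 := by
    have hd' : HasFDerivAt (energyCons p b) (fderiv ℝ (energyCons p b) W.cons)
        (W.cons + (0 : ℝ) • q) := by simpa using hd
    exact hd'.comp_hasDerivAt (0 : ℝ) hline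
  have hk (k : Fin 4) : HasDerivAt (fun s : ℝ => W.cons k + s * q k) (q k) 0 := by
    simpa using ((hasDerivAt_id (0 : ℝ)).mul_const (q k)).const_add (W.cons k)
  have z (k : Fin 4) : W.cons k + 0 * q k = W.cons k := by ring
  have c0 : W.cons 0 = W.h := rfl
  have c1 : W.cons 1 = W.h * W.u := rfl
  have c2 : W.cons 2 = W.h * W.sxx := rfl
  have c3 : W.cons 3 = W.h * W.szz := rfl
  have hne : W.cons 0 + 0 * q 0 ≠ 0 := by rw [z, c0]; exact h.ne'
  have sx := hW.sxx_pos.ne'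
  have sz := hW.szz_pos.ne'
  have du := (hk 1).div (hk 0) hne
  have dx := (hk 2).div (hk 0) hne
  have dz := (hk 3).div (hk 0) hne
  have dl := (dx.mul dz).log (by simp [c0, c2, c3, h.ne', sx, sz])
  have h2 := (((((hk 0).mul (du.pow 2)).div_const 2).add
    ((((hk 0).pow 2).const_mul p.g).div_const 2)).add
    (((hk 0).const_mul p.g).mul_const b)).add
    (((hk 0).mul (((dx.add dz).sub dl).sub_const 2)).const_mul (p.etap / (4 * p.lam)))
  have h3 := h1.unique (f := fun s : ℝ => energyCons p b (W.cons + s • q)) h2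
  rw [h3]
  simp only [energyGrad, Pi.mul_apply, Pi.div_apply, Pi.add_apply, Pi.sub_apply, Pi.pow_apply,
    zero_mul, add_zero, c0, c1, c2, c3, mul_div_cancel_left₀ _ h.ne']
  have := p.lam_pos.ne'
  field_simp
  ring

/-- Convexity of the energy: it lies above its tangents, also those at dry states. -/
lemma energyGrad_le (p : Params) (hV0 : 0 ≤ V.h) (hV : 0 < V.h → 0 < V.sxx ∧ 0 < V.szz)
    (hW : W.Admissible) :
    energyGrad p W b (V.cons - W.cons) ≤ energy p V b - energy p W b := by
  have hmu : 0 ≤ p.etap / (4 * p.lam) :=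
    div_nonneg p.etap_pos.le (mul_nonneg (by norm_num) p.lam_pos.le)
  have hg := p.g_pos
  have sx := hW.sxx_pos
  have sz := hW.szz_pos
  -- The exact convexity remainder: two squares and a relative entropy, all weighted nonnegatively.
  -- The entropy is controlled by `log x ≤ x - 1` at the quotients of the stresses.
  have e : energy p V b - energy p W b - energyGrad p W b (V.cons - W.cons) =
      V.h * (V.u - W.u) ^ 2 / 2 + p.g * (V.h - W.h) ^ 2 / 2 +
      p.etap / (4 * p.lam) * (V.h * ((V.sxx / W.sxx + V.szz / W.szz - 2) -
        (Real.log (V.sxx * V.szz) - Real.log (W.sxx * W.szz)))) := by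
    simp only [energy, energyGrad, State.cons, Pi.sub_apply, Matrix.cons_val_zero,
      Matrix.cons_val_one, Matrix.cons_val]
    field_simp
    ring
  have hD : 0 ≤ V.h * ((V.sxx / W.sxx + V.szz / W.szz - 2) -
        (Real.log (V.sxx * V.szz) - Real.log (W.sxx * W.szz))) := by
    rcases hV0.eq_or_lt with h | h
    · simp [← h]
    · obtain ⟨vx, vz⟩ := hV h
      refine mul_nonneg hV0 ?_
      have lx := Real.log_le_sub_one_of_pos (div_pos vx sx)
      have lz := Real.log_le_sub_one_of_pos (div_pos vz sz)
      rw [Real.log_div vx.ne' sx.ne'] at lx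
      rw [Real.log_div vz.ne' sz.ne'] at lz
      rw [Real.log_mul vx.ne' vz.ne', Real.log_mul sx.ne' sz.ne']
      linarith
  have : 0 ≤ V.h * (V.u - W.u) ^ 2 / 2 + p.g * (V.h - W.h) ^ 2 / 2 := by positivity
  have := mul_nonneg hmu hD
  linarith

/-- At a dry side the convention `0 / 0 = 0` gives the intermediate state zero stresses, so it is
not admissible. Convexity needs positive stresses only when the height is positive. -/
lemma starL_wet (p : Params) (hL : L.Admissible) (hR : R.Admissible)
    (h : 0 < (starL p L R).h) : 0 < (starL p L R).sxx ∧ 0 < (starL p L R).szz := by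
  have hLh : 0 < L.h := by
    rcases hL.h_nonneg.eq_or_lt with h0 | h0
    · simp [starL, hStarL_of_dry p h0.symm] at h
    · exact h0
  have := hStarL_pos p hL hR hLh
  have := hL.sxx_pos
  have := hL.szz_pos
  simp only [starL]
  constructor <;> positivity

lemma starR_wet (p : Params) (hL : L.Admissible) (hR : R.Admissible)
    (h : 0 < (starR p L R).h) : 0 < (starR p L R).sxx ∧ 0 < (starR p L R).szz := by
  have := starL_wet p hR.mirror hL.mirror
  rw [starL_mirror] at this
  exact this h

/-- The reduced energy inequality of one side of the Riemann fan, in terms of `y = h / h*`. -/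
lemma relaxed_energy_aux {g h sx sz μ a X w y : ℝ} (hg : 0 < g) (hh : 0 < h) (hsx : 0 < sx)
    (hsz : 0 < sz) (hμ : 0 < μ) (ha : 0 < a) (hX : 0 ≤ X) (hw : w = a + 2 * X)
    (ha2 : a ^ 2 = g * h + 2 * μ * (3 * sz + sx)) (hy : (a + X) ≤ y * (a + 2 * X)) :
    g * h / 2 * (1 / y - 1) + μ * (sx * (y ^ 2 - 1) + sz * ((1 / y) ^ 2 - 1)) ≤
      -(g * h / 2 + 2 * μ * (sz - sx)) * (y - 1) + w ^ 2 / 2 * (y - 1) ^ 2 := by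
  have hy0 : 0 < y := by
    by_contra hc
    have := mul_nonneg (neg_nonneg.2 (not_lt.1 hc)) (show 0 ≤ a + 2 * X by linarith)
    linarith
  -- Both sides agree to first order at `y = 1`, which produces the factor `(y - 1) ^ 2`. What
  -- remains is a subcharacteristic condition along the passage from `h` to `h / y`.
  have e : -(g * h / 2 + 2 * μ * (sz - sx)) * (y - 1) + w ^ 2 / 2 * (y - 1) ^ 2 -
      (g * h / 2 * (1 / y - 1) + μ * (sx * (y ^ 2 - 1) + sz * ((1 / y) ^ 2 - 1))) =
      (y - 1) ^ 2 / (2 * y ^ 2) * (w ^ 2 * y ^ 2 - g * h * y -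
        2 * μ * (sx * y ^ 2 + sz * (2 * y + 1))) := by
    field_simp
    ring
  have hwy : a + X ≤ w * y := by rw [hw]; linarith
  have haw : a ≤ w := by linarith
  have key : 0 ≤ w ^ 2 * y ^ 2 - g * h * y - 2 * μ * (sx * y ^ 2 + sz * (2 * y + 1)) := by
    have hgh := mul_pos hg hh
    have hms := mul_pos hμ hsx
    have hmz := mul_pos hμ hsz
    -- Under compression, `y ≤ 1`, the bound `w y ≥ a` is decisive and the powers of `y` are at most
    -- 1. Under expansion `w ≥ a` suffices, with all lower powers bounded by `y ^ 2`.
    rcases le_total y 1 with h1 | h1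
    · have h2 : a ^ 2 ≤ w ^ 2 * y ^ 2 := by
        rw [← mul_pow]
        exact pow_le_pow_left₀ ha.le (by linarith) 2
      have h3 : y ^ 2 ≤ 1 := pow_le_one₀ hy0.le h1
      have := mul_le_mul_of_nonneg_left h1 hgh.le
      have := mul_le_mul_of_nonneg_left h1 hmz.le
      have := mul_le_mul_of_nonneg_left h3 hms.le
      nlinarith
    · have h2 : a ^ 2 * y ^ 2 ≤ w ^ 2 * y ^ 2 :=
        mul_le_mul_of_nonneg_right (pow_le_pow_left₀ ha.le haw 2) (sq_nonneg y)
      have h3 : y ≤ y ^ 2 := by nlinarith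
      have := mul_le_mul_of_nonneg_left h3 hgh.le
      have := mul_le_mul_of_nonneg_left h3 hmz.le
      have := mul_le_mul_of_nonneg_left (h1.trans h3) hmz.le
      nlinarith
  have := mul_nonneg (div_nonneg (sq_nonneg (y - 1)) (by positivity : 0 ≤ 2 * y ^ 2)) key
  linarith

/-- The energy per mass. -/
noncomputable def massEnergy (p : Params) (W : State) : ℝ :=
  W.u ^ 2 / 2 + p.g * W.h / 2 +
    p.etap / (4 * p.lam) * (W.sxx + W.szz - Real.log (W.sxx * W.szz) - 2)

lemma energy_eq_massEnergy (p : Params) (W : State) : energy p W 0 = W.h * massEnergy p W := by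
  simp only [energy, massEnergy]; ring

/-- The energy inequality of the left side of the Riemann fan. -/
lemma left_fan_energy (p : Params) (hL : L.Admissible) (hR : R.Admissible) (h : 0 < L.h) :
    piStar p L R * uStar p L R - pressure p L * L.u ≤
      cL p L R * (massEnergy p L - massEnergy p (starL p L R)) := by
  have hg := p.g_pos
  have sx := hL.sxx_pos
  have sz := hL.szz_pos
  have hμ : 0 < p.etap / (4 * p.lam) :=
    div_pos p.etap_pos (mul_pos (by norm_num) p.lam_pos)
  have h0 : 0 < L.h + R.h := by linarith [hR.h_nonneg]
  have hS := (cL_add_cR_pos p hL hR h0).ne'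
  have ha := soundSpeed_pos p hL
  have hw := ratioL_pos p hL hR
  have hc := cL_pos p hL hR h
  have hs := hStarL_pos p hL hR h
  have hmul := hStarL_mul p hL hR
  set r := hStarL p L R with hr
  set x := uStar p L R - L.u with hx
  set w := ratioL p L R with hwdef
  have hcw : cL p L R = L.h * w := rfl
  have hs21 : speed2 p L R - speed1 p L R = x + w := by
    simp only [hx, speed1, speed2, hwdef]; ring
  rw [hs21, hcw] at hmul
  set y := L.h / r with hy
  have hyw : y * w = x + w := by
    rw [hy, div_mul_eq_mul_div, ← hmul]; field_simp
  have hmu2 : p.etap / (2 * p.lam) = 2 * (p.etap / (4 * p.lam)) := by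
    have := p.lam_pos.ne'
    field_simp; norm_num
  -- Here `X` is half of the excess of `ratioL` over the sound speed; since `y w = u_* - u_l + w`,
  -- `uStar_sub_left_ge` supplies exactly the required lower bound.
  have aux := relaxed_energy_aux (w := w) (y := y) (X := (w - soundSpeed p L) / 2) hg h sx sz hμ ha
    (by linarith [soundSpeed_le_ratioL p hL hR]) (by ring)
    (by rw [soundSpeed_sq p hL, hmu2])
    (by have := uStar_sub_left_ge p hL hR h0
        rw [show soundSpeed p L + 2 * ((w - soundSpeed p L) / 2) = w by ring, hyw]
        linarith)
  have hy0 : 0 < y := div_pos h hs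
  have hry : r = L.h * (1 / y) := by rw [hy]; field_simp
  -- The product of the two stresses does not change across the wave, so the logarithmic part of the
  -- energy drops out.
  have hlog : Real.log (L.sxx * y ^ 2 * (L.szz * (1 / y) ^ 2)) = Real.log (L.sxx * L.szz) := by
    congr 1; field_simp
  have hstar : massEnergy p (starL p L R) = (L.u + x) ^ 2 / 2 + p.g * (L.h * (1 / y)) / 2 +
      p.etap / (4 * p.lam) * (L.sxx * y ^ 2 + L.szz * (1 / y) ^ 2 -
        Real.log (L.sxx * L.szz) - 2) := by
    have e1 : starL p L R = ⟨L.h * (1 / y), L.u + x, L.sxx * y ^ 2, L.szz * (1 / y) ^ 2⟩ := by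
      ext
      · exact hry
      · simp [starL, hx]
      · rfl
      · simp only [starL, ← hr, hy, one_div_div]
    rw [e1, massEnergy, hlog]
  have hP : pressure p L = L.h * (p.g * L.h / 2 +
      2 * (p.etap / (4 * p.lam)) * (L.szz - L.sxx)) := by
    rw [pressure, hmu2]; ring
  have hpi : piStar p L R = pressure p L - L.h * w * x := piStar_eq_left p hS
  have hxw : x = w * (y - 1) := by linarith
  rw [hpi, show uStar p L R = L.u + x by simp [hx], hstar, massEnergy, hcw, hP]
  have := mul_le_mul_of_nonneg_left aux (mul_pos h hw).le
  rw [hxw]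
  nlinarith

lemma massEnergy_mirror : massEnergy p W.mirror = massEnergy p W := by
  simp [massEnergy]

lemma right_fan_energy (p : Params) (hL : L.Admissible) (hR : R.Admissible) (h : 0 < R.h) :
    pressure p R * R.u - piStar p L R * uStar p L R ≤
      cR p L R * (massEnergy p R - massEnergy p (starR p L R)) := by
  have := left_fan_energy p hR.mirror hL.mirror h
  simp only [piStar_mirror, uStar_mirror, pressure_mirror, State.mirror_u, cL_mirror,
    starL_mirror, massEnergy_mirror] at this
  linarith

/-- The energy is dissipated across the Riemann fan. -/
lemma energy_waves (p : Params) (hL : L.Admissible) (hR : R.Admissible) :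
    energyFlux p R 0 - energyFlux p L 0 ≤
      leftSum p (fun V => energy p V 0) L R + rightSum p (fun V => energy p V 0) L R := by
  have hdry (V : State) (hV : V.h = 0) : energy p V 0 = 0 := by simp [energy, hV]
  rcases (add_nonneg hL.h_nonneg hR.h_nonneg).eq_or_lt with h0 | h0
  · have h1 : L.h = 0 := by linarith [hL.h_nonneg, hR.h_nonneg]
    have h2 : R.h = 0 := by linarith [hL.h_nonneg, hR.h_nonneg]
    rw [leftSum_of_dry p _ hdry h1 h2, rightSum_of_dry p _ hdry h1 h2]
    simp [energyFlux, hdry, h1, h2, pressure_of_dry]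
  · rw [leftSum_add_rightSum]
    simp only [energyFlux, energy_eq_massEnergy]
    have e1 := hStarL_mul p hL hR
    have e2 := hStarR_mul p hL hR
    have e3 := left_mul p (L := L) (R := R)
    have e4 := right_mul p (L := L) (R := R)
    have hS := (cL_add_cR_pos p hL hR h0).ne'
    have f1 : piStar p L R * uStar p L R - pressure p L * L.u ≤
        cL p L R * (massEnergy p L - massEnergy p (starL p L R)) := by
      -- On a dry side the relaxation speed, the pressure and hence `piStar` vanish, and the
      -- inequality is `0 ≤ 0`.
      rcases hL.h_nonneg.eq_or_lt with h | h
      · have hc : cL p L R = 0 := by simp [cL, ← h]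
        rw [piStar_eq_left p hS, hc, pressure_of_dry p h.symm]
        simp
      · exact left_fan_energy p hL hR h
    have f2 : pressure p R * R.u - piStar p L R * uStar p L R ≤
        cR p L R * (massEnergy p R - massEnergy p (starR p L R)) := by
      rcases hR.h_nonneg.eq_or_lt with h | h
      · have hc : cR p L R = 0 := by simp [cR, ← h]
        rw [piStar_eq_right p hS, hc, pressure_of_dry p h.symm]
        simp
      · exact right_fan_energy p hL hR h
    have s1 : (starL p L R).h = hStarL p L R := rfl
    have s2 : (starR p L R).h = hStarR p L R := rfl
    rw [s1, s2]
    have : speed1 p L R * (hStarL p L R * massEnergy p (starL p L R) - L.h * massEnergy p L) +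
        speed2 p L R * (hStarR p L R * massEnergy p (starR p L R) -
          hStarL p L R * massEnergy p (starL p L R)) +
        speed3 p L R * (R.h * massEnergy p R - hStarR p L R * massEnergy p (starR p L R)) =
        cL p L R * (massEnergy p L - massEnergy p (starL p L R)) +
        cR p L R * (massEnergy p R - massEnergy p (starR p L R)) +
        R.h * massEnergy p R * R.u - L.h * massEnergy p L * L.u := by
      linear_combination -massEnergy p (starL p L R) * e1 - massEnergy p (starR p L R) * e2 +
        massEnergy p L * e3 + massEnergy p R * e4
    rw [this]
    linarith

/-- By summation by parts, `leftSum p f` is a combination, with the same nonpositive weights for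
every `f`, of the differences of `f` between `L^*`, `R^*`, `R` and the state `L`. Convexity of the
energy at `L` is applied to each difference, with no restriction on the time step. -/
lemma leftSum_energy_le (p : Params) (hL : L.Admissible) (hR : R.Admissible) :
    leftSum p (fun V => energy p V 0) L R ≤
      energyGrad p L 0 (fun k => leftSum p (fun V => V.cons k) L R) := by
  have hdry (V : State) (hV : V.h = 0) : energy p V 0 = 0 := by simp [energy, hV]
  rcases (add_nonneg hL.h_nonneg hR.h_nonneg).eq_or_lt with h0 | h0
  · have h1 : L.h = 0 := by linarith [hL.h_nonneg, hR.h_nonneg]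
    have h2 : R.h = 0 := by linarith [hL.h_nonneg, hR.h_nonneg]
    rw [leftSum_of_dry p _ hdry h1 h2]
    simp only [fun k => leftSum_of_dry p _ (fun V h => cons_of_dry h k) h1 h2]
    simp [energyGrad]
  · have n2 : 0 ≤ min 0 (speed2 p L R) - min 0 (speed1 p L R) :=
      sub_nonneg.2 (min_le_min_left _ (speed1_lt_speed2 p hL hR h0).le)
    have n3 : 0 ≤ min 0 (speed3 p L R) - min 0 (speed2 p L R) :=
      sub_nonneg.2 (min_le_min_left _ (speed2_lt_speed3 p hL hR h0).le)
    have n4 : 0 ≤ -min 0 (speed3 p L R) := neg_nonneg.2 (min_le_left _ _)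
    have c2 := energyGrad_le (b := 0) p (hStarL_nonneg p hL hR) (starL_wet p hL hR) hL
    have c3 := energyGrad_le (b := 0) p (hStarR_nonneg p hL hR) (starR_wet p hL hR) hL
    have c4 := energyGrad_le (b := 0) p hR.h_nonneg (fun _ => ⟨hR.sxx_pos, hR.szz_pos⟩) hL
    have t2 := mul_le_mul_of_nonneg_left c2 n2
    have t3 := mul_le_mul_of_nonneg_left c3 n3
    have t4 := mul_le_mul_of_nonneg_left c4 n4
    simp only [energyGrad, Pi.sub_apply] at t2 t3 t4 ⊢
    simp only [leftSum]
    linarith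

lemma rightSum_energy_le (p : Params) (hL : L.Admissible) (hR : R.Admissible) :
    rightSum p (fun V => energy p V 0) L R ≤
      energyGrad p R 0 (fun k => rightSum p (fun V => V.cons k) L R) := by
  have h := leftSum_energy_le p hR.mirror hL.mirror
  rw [leftSum_mirror p _ (fun V => energy p V 0) (fun V => by simp [energy])] at h
  simp only [fun k => leftSum_mirror p (L := L) (R := R) (fun V => V.cons k)
    (fun V => V.mirror.cons k) (fun V => rfl)] at h
  have e : rightSum p (fun V => V.mirror.cons 1) L R = -rightSum p (fun V => V.cons 1) L R := by
    simp only [rightSum, State.cons, State.mirror_h, State.mirror_u, Matrix.cons_val_one,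
      Matrix.cons_val_zero]
    ring
  simp only [energyGrad, State.mirror_u, State.mirror_h, State.mirror_sxx, State.mirror_szz, e]
    at h ⊢
  refine h.trans_eq ?_
  simp only [State.cons, State.mirror_h, State.mirror_sxx, State.mirror_szz,
    Matrix.cons_val_zero, Matrix.cons_val]
  ring

/-- The numerical energy flux. -/
noncomputable def numEnergyFlux (p : Params) (L R : State) (bl br : ℝ) : ℝ :=
  energyFlux p (sharpL L (br - bl)) 0 +
    leftSum p (fun V => energy p V 0) (sharpL L (br - bl)) (sharpR R (br - bl)) +
    p.g * max bl br * massFlux p (sharpL L (br - bl)) (sharpR R (br - bl))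

lemma numEnergyFlux_self (p : Params) (hW : W.Admissible) (b : ℝ) :
    numEnergyFlux p W W b b = energyFlux p W b := by
  have hdry (V : State) (hV : V.h = 0) : energy p V 0 = 0 := by simp [energy, hV]
  rw [numEnergyFlux, sub_self, sharpL_zero hW, sharpR_zero hW, leftSum_self p _ hdry hW,
    massFlux_eq p hW hW, leftSum_self p _ (fun _ h => h) hW, max_self]
  simp only [energyFlux, energy]
  ring

/-- Sign of the topographic defect: the bracket is zero unless the height was cut off at zero, and
then it is nonpositive, as is the outgoing mass flux `m`. -/
lemma mass_le_of_reconstruction {m h d : ℝ} (hm : max 0 (h - max 0 d) = 0 → m ≤ 0) :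
    0 ≤ m * (h - max 0 (h - max 0 d) - max 0 d) := by
  rcases le_total 0 (h - max 0 d) with h0 | h0
  · rw [max_eq_right h0]
    simp
  · rw [max_eq_left h0] at hm ⊢
    exact mul_nonneg_of_nonpos_of_nonpos (hm rfl) (by linarith)

/-- Passing from the reconstructed state to the cell state costs exactly `g m (h - h♯ - (max b_l b_r
- b_l))`. The level `max b_l b_r` in the energy flux is what makes this the quantity of
`mass_le_of_reconstruction`. -/
lemma numEnergyFlux_le_left (p : Params) (hL : L.Admissible) (hR : R.Admissible) (bl br : ℝ) :
    numEnergyFlux p L R bl br ≤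
      energyFlux p L bl + energyGrad p L bl (fluxL p L R (br - bl) - flux p L) := by
  have hL' := sharpL_admissible hL (br - bl)
  have hR' := sharpR_admissible hR (br - bl)
  obtain ⟨l0, l1, l2, l3⟩ := fluxL_apply p hL hR (br - bl)
  have hE := leftSum_energy_le p hL' hR'
  have hm : (sharpL L (br - bl)).h = 0 →
      leftFlux p State.h (sharpL L (br - bl)) (sharpR R (br - bl)) ≤ 0 :=
    leftFlux_nonpos_of_dry p wetPositive_h hL' hR'
  have hb : max bl br - bl = max 0 (br - bl) := by
    rw [max_sub_sub_right bl br bl |>.symm, sub_self]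
  have hpos := mass_le_of_reconstruction hm
  change 0 ≤ _ * (L.h - (sharpL L (br - bl)).h - _) at hpos
  rw [← hb] at hpos
  have hpos := mul_nonneg p.g_pos.le hpos
  refine (?_ : _ ≤ energyFlux p (sharpL L (br - bl)) 0 +
    energyGrad p (sharpL L (br - bl)) 0 (fun k => leftSum p (fun V => V.cons k)
      (sharpL L (br - bl)) (sharpR R (br - bl))) + p.g * max bl br *
      leftFlux p State.h (sharpL L (br - bl)) (sharpR R (br - bl))).trans ?_
  · rw [numEnergyFlux, massFlux_eq p hL' hR', leftFlux]
    linarith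
  · rw [← sub_nonneg]
    refine hpos.trans_eq ?_
    have sx := hL.sxx_pos.ne'
    have sz := hL.szz_pos.ne'
    have hu : (sharpL L (br - bl)).u = L.u := rfl
    have hx : (sharpL L (br - bl)).sxx = L.sxx := rfl
    have hz : (sharpL L (br - bl)).szz = L.szz := rfl
    simp only [energyGrad, Pi.sub_apply, l0, l1, l2, l3, leftFlux, State.cons,
      Matrix.cons_val_zero, Matrix.cons_val_one, Matrix.cons_val, flux, energyFlux, energy,
      pressure, hu, hx, hz]
    have := p.lam_pos.ne'
    field_simp
    ring

/-- The energy flux is built from the left state, so `energy_waves` is needed here: dissipation in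
the fan converts a bound by the right wave sum into one by the left wave sum. -/
lemma right_le_numEnergyFlux (p : Params) (hL : L.Admissible) (hR : R.Admissible) (bl br : ℝ) :
    energyFlux p R br + energyGrad p R br (fluxR p L R (br - bl) - flux p R) ≤
      numEnergyFlux p L R bl br := by
  have hL' := sharpL_admissible hL (br - bl)
  have hR' := sharpR_admissible hR (br - bl)
  obtain ⟨r0, r1, r2, r3⟩ := fluxR_apply p hL hR (br - bl)
  have hE := rightSum_energy_le p hL' hR'
  have hm : (sharpR R (br - bl)).h = 0 →
      -rightFlux p State.h (sharpL L (br - bl)) (sharpR R (br - bl)) ≤ 0 := fun h =>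
    neg_nonpos.2 (rightFlux_nonneg_of_dry p wetPositive_h hL' hR' h)
  have hb : max bl br - br = max 0 (-(br - bl)) := by
    rw [max_sub_sub_right bl br br |>.symm, sub_self, max_comm, neg_sub]
  have hpos := mass_le_of_reconstruction hm
  change 0 ≤ _ * (R.h - (sharpR R (br - bl)).h - _) at hpos
  rw [← hb] at hpos
  have hpos := mul_nonneg p.g_pos.le hpos
  refine le_trans ?_ (?_ : energyFlux p (sharpR R (br - bl)) 0 -
    energyGrad p (sharpR R (br - bl)) 0 (fun k => rightSum p (fun V => V.cons k)
      (sharpL L (br - bl)) (sharpR R (br - bl))) + p.g * max bl br *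
      rightFlux p State.h (sharpL L (br - bl)) (sharpR R (br - bl)) ≤ _)
  · rw [← sub_nonneg]
    refine hpos.trans_eq ?_
    have sx := hR.sxx_pos.ne'
    have sz := hR.szz_pos.ne'
    have hu : (sharpR R (br - bl)).u = R.u := rfl
    have hx : (sharpR R (br - bl)).sxx = R.sxx := rfl
    have hz : (sharpR R (br - bl)).szz = R.szz := rfl
    simp only [energyGrad, Pi.sub_apply, r0, r1, r2, r3, rightFlux, State.cons,
      Matrix.cons_val_zero, Matrix.cons_val_one, Matrix.cons_val, flux, energyFlux, energy,
      pressure, hu, hx, hz]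
    have := p.lam_pos.ne'
    field_simp
    ring
  · have hw := energy_waves p hL' hR'
    have hmw := mass_waves p hL' hR'
    have : massFlux p (sharpL L (br - bl)) (sharpR R (br - bl)) =
        rightFlux p State.h (sharpL L (br - bl)) (sharpR R (br - bl)) := by
      rw [massFlux_eq p hL' hR', rightFlux]
      linarith
    rw [numEnergyFlux, this]
    linarith

/-- The chain rule turns the evolution of `q` into the difference of the two interface expressions;
the exact energy flux of the cell appears in both and cancels. -/
lemma energy_decay (p : Params) (dx : ℤ → ℝ) (b : ℤ → ℝ) (W : ℝ → ℤ → State) (t : ℝ) (i : ℤ)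
    (hdx : ∀ j, 0 < dx j) (hW : ∀ j, (W t j).Admissible) (h : 0 < (W t i).h)
    (hd : HasDerivAt (fun s => (W s i).cons) (-((1 / dx i) • fluxDiff p b (W t) i)) t) :
    ∃ D : ℝ, HasDerivAt (fun s => energy p (W s i) (b i)) D t ∧
      D + 1 / dx i * (numEnergyFlux p (W t i) (W t (i + 1)) (b i) (b (i + 1)) -
        numEnergyFlux p (W t (i - 1)) (W t i) (b (i - 1)) (b i)) ≤ 0 := by
  have hE := (energyCons_differentiableAt p (b i) (hW i) h).hasFDerivAt.comp_hasDerivAt t hd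
  refine ⟨_, hE.congr_of_eventuallyEq ?_, ?_⟩
  · have hc : ContinuousAt (fun s => (W s i).h) t :=
      (hasDerivAt_pi.1 hd 0).continuousAt
    filter_upwards [hc.eventually_ne h.ne'] with s hs
    simp only [Function.comp, energyCons, ofCons_cons hs]
  · rw [fderiv_energyCons p (b i) (hW i) h]
    have h1 := numEnergyFlux_le_left p (hW i) (hW (i + 1)) (b i) (b (i + 1))
    have h2 := right_le_numEnergyFlux p (hW (i - 1)) (hW i) (b (i - 1)) (b i)
    have hi : 0 < 1 / dx i := one_div_pos.2 (hdx i)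
    have e : energyGrad p (W t i) (b i) (-((1 / dx i) • fluxDiff p b (W t) i)) =
        1 / dx i * (energyGrad p (W t i) (b i)
            (fluxR p (W t (i - 1)) (W t i) (b i - b (i - 1)) - flux p (W t i)) -
          energyGrad p (W t i) (b i)
            (fluxL p (W t i) (W t (i + 1)) (b (i + 1) - b i) - flux p (W t i))) := by
      simp only [energyGrad, fluxDiff, Pi.neg_apply, Pi.smul_apply, Pi.sub_apply, smul_eq_mul]
      ring
    rw [e, ← mul_add]
    exact mul_nonpos_of_nonneg_of_nonpos hi.le (by linarith)

lemma semiDiscreteEnergy (p : Params) : SemiDiscreteEnergy p (numEnergyFlux p) where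
  consistent _ b hW := numEnergyFlux_self p hW b
  differentiable _ b hW h := energyCons_differentiableAt p b hW h
  right_le L R bl br hL hR h := by
    rw [fderiv_energyCons p br hR h]
    exact right_le_numEnergyFlux p hL hR bl br
  le_left L R bl br hL hR h := by
    rw [fderiv_energyCons p bl hL h]
    exact numEnergyFlux_le_left p hL hR bl br
  energy_decay := energy_decay p

end Energy

/-! ### Limits of the solver and of the left flux at a wet state. -/

section Limits

variable {α : Type*} {l : Filter α} {p : Params} {L R : α → State} {W : State}
  {db e : α → ℝ}

/-- Componentwise convergence of states. -/
structure StateTendsto (l : Filter α) (L : α → State) (W : State) : Prop where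
  h : Tendsto (fun a => (L a).h) l (𝓝 W.h)
  u : Tendsto (fun a => (L a).u) l (𝓝 W.u)
  sxx : Tendsto (fun a => (L a).sxx) l (𝓝 W.sxx)
  szz : Tendsto (fun a => (L a).szz) l (𝓝 W.szz)

lemma StateTendsto.const (l : Filter α) (W : State) : StateTendsto l (fun _ => W) W :=
  ⟨tendsto_const_nhds, tendsto_const_nhds, tendsto_const_nhds, tendsto_const_nhds⟩

lemma StateTendsto.mirror (hL : StateTendsto l L W) :
    StateTendsto l (fun a => (L a).mirror) W.mirror :=
  ⟨hL.h, hL.u.neg, hL.sxx, hL.szz⟩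

lemma StateTendsto.eventually_wet (hL : StateTendsto l L W) (hW : W.Admissible) (h : 0 < W.h) :
    ∀ᶠ a in l, (L a).Admissible ∧ 0 < (L a).h := by
  filter_upwards [hL.h.eventually_const_lt h, hL.sxx.eventually_const_lt hW.sxx_pos,
    hL.szz.eventually_const_lt hW.szz_pos] with a h1 h2 h3
  exact ⟨⟨h1.le, h2, h3⟩, h1⟩

lemma StateTendsto.tendsto_pressure (p : Params) (hL : StateTendsto l L W) :
    Tendsto (fun a => pressure p (L a)) l (𝓝 (pressure p W)) :=
  (((hL.h.pow 2).const_mul p.g).div_const 2).add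
    ((hL.h.mul (hL.szz.sub hL.sxx)).const_mul _)

lemma StateTendsto.tendsto_cons (hL : StateTendsto l L W) (k : Fin 4) :
    Tendsto (fun a => (L a).cons k) l (𝓝 (W.cons k)) := by
  fin_cases k
  · exact hL.h
  · exact hL.h.mul hL.u
  · exact hL.h.mul hL.sxx
  · exact hL.h.mul hL.szz

lemma StateTendsto.tendsto_flux (p : Params) (hL : StateTendsto l L W) (k : Fin 4) :
    Tendsto (fun a => flux p (L a) k) l (𝓝 (flux p W k)) := by
  fin_cases k
  · exact hL.h.mul hL.u
  · exact (hL.h.mul (hL.u.pow 2)).add (hL.tendsto_pressure p)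
  · exact (hL.h.mul hL.sxx).mul hL.u
  · exact (hL.h.mul hL.szz).mul hL.u

lemma StateTendsto.tendsto_soundSpeed (p : Params) (hL : StateTendsto l L W) :
    Tendsto (fun a => soundSpeed p (L a)) l (𝓝 (soundSpeed p W)) :=
  ((hL.h.const_mul p.g).add (((hL.szz.const_mul 3).add hL.sxx).const_mul _)).sqrt

lemma StateTendsto.tendsto_ratioL (p : Params) (hL : StateTendsto l L W) (hR : StateTendsto l R W)
    (hW : W.Admissible) (h : 0 < W.h) :
    Tendsto (fun a => ratioL p (L a) (R a)) l (𝓝 (soundSpeed p W)) := by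
  have hN := (weightedSpeeds_pos p hW hW (by linarith)).ne'
  have := (hL.tendsto_soundSpeed p).add
    ((((tendsto_const_nhds (x := (0 : ℝ))).max (hL.u.sub hR.u)).add
    (((tendsto_const_nhds (x := (0 : ℝ))).max
      ((hR.tendsto_pressure p).sub (hL.tendsto_pressure p))).div
      ((hL.h.mul (hL.tendsto_soundSpeed p)).add (hR.h.mul
        (hR.tendsto_soundSpeed p))) hN)).const_mul 2)
  simpa [ratioL] using this

lemma StateTendsto.tendsto_ratioR (p : Params) (hL : StateTendsto l L W) (hR : StateTendsto l R W)
    (hW : W.Admissible) (h : 0 < W.h) :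
    Tendsto (fun a => ratioR p (L a) (R a)) l (𝓝 (soundSpeed p W)) := by
  simpa using hR.mirror.tendsto_ratioL p hL.mirror hW.mirror h

lemma StateTendsto.tendsto_cL (p : Params) (hL : StateTendsto l L W) (hR : StateTendsto l R W)
    (hW : W.Admissible) (h : 0 < W.h) :
    Tendsto (fun a => cL p (L a) (R a)) l (𝓝 (W.h * soundSpeed p W)) :=
  hL.h.mul (hL.tendsto_ratioL p hR hW h)

lemma StateTendsto.tendsto_cR (p : Params) (hL : StateTendsto l L W) (hR : StateTendsto l R W)
    (hW : W.Admissible) (h : 0 < W.h) :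
    Tendsto (fun a => cR p (L a) (R a)) l (𝓝 (W.h * soundSpeed p W)) :=
  hR.h.mul (hL.tendsto_ratioR p hR hW h)

lemma StateTendsto.tendsto_uStar (p : Params) (hL : StateTendsto l L W) (hR : StateTendsto l R W)
    (hW : W.Admissible) (h : 0 < W.h) :
    Tendsto (fun a => uStar p (L a) (R a)) l (𝓝 W.u) := by
  have ha := (soundSpeed_pos p hW).ne'
  have hc := mul_pos h (soundSpeed_pos p hW)
  have := (((((hL.tendsto_cL p hR hW h).mul hL.u).add ((hL.tendsto_cR p hR hW h).mul hR.u)).add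
    (hL.tendsto_pressure p)).sub (hR.tendsto_pressure p)).div
    ((hL.tendsto_cL p hR hW h).add (hL.tendsto_cR p hR hW h))
    (by positivity)
  refine this.trans_eq ?_
  congr 1
  field_simp
  ring

lemma StateTendsto.tendsto_speed1 (p : Params) (hL : StateTendsto l L W) (hR : StateTendsto l R W)
    (hW : W.Admissible) (h : 0 < W.h) :
    Tendsto (fun a => speed1 p (L a) (R a)) l (𝓝 (W.u - soundSpeed p W)) :=
  hL.u.sub (hL.tendsto_ratioL p hR hW h)

lemma StateTendsto.tendsto_speed3 (p : Params) (hL : StateTendsto l L W) (hR : StateTendsto l R W)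
    (hW : W.Admissible) (h : 0 < W.h) :
    Tendsto (fun a => speed3 p (L a) (R a)) l (𝓝 (W.u + soundSpeed p W)) :=
  hR.u.add (hL.tendsto_ratioR p hR hW h)

lemma StateTendsto.tendsto_hStarL (p : Params) (hL : StateTendsto l L W) (hR : StateTendsto l R W)
    (hW : W.Admissible) (h : 0 < W.h) :
    Tendsto (fun a => hStarL p (L a) (R a)) l (𝓝 W.h) := by
  have hc := mul_pos h (soundSpeed_pos p hW)
  have := (tendsto_const_nhds (x := (1 : ℝ))).div
    (((tendsto_const_nhds (x := (1 : ℝ))).div hL.h h.ne').add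
    (((((hL.tendsto_cR p hR hW h).mul (hR.u.sub hL.u)).add
    (hL.tendsto_pressure p)).sub (hR.tendsto_pressure p)).div ((hL.tendsto_cL p hR hW h).mul
    ((hL.tendsto_cL p hR hW h).add (hL.tendsto_cR p hR hW h)))
    (by positivity))) (by simp [h.ne'])
  exact this.trans_eq (by simp)

/-- The quotients of the jumps across the first wave by the jump of the velocity. -/
noncomputable def slopeL (p : Params) (L R : State) : Fin 4 → ℝ :=
  ![-(hStarL p L R / ratioL p L R), hStarL p L R - L.u * (hStarL p L R / ratioL p L R),
    L.sxx * L.h / ratioL p L R,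
    -(L.szz * (hStarL p L R / ratioL p L R) *
      (hStarL p L R ^ 2 + hStarL p L R * L.h + L.h ^ 2) / L.h ^ 2)]

/-- The quotients of the jumps across the third wave by the jump of the velocity. -/
noncomputable def slopeR (p : Params) (L R : State) : Fin 4 → ℝ :=
  ![-slopeL p R.mirror L.mirror 0, slopeL p R.mirror L.mirror 1,
    -slopeL p R.mirror L.mirror 2, -slopeL p R.mirror L.mirror 3]

/-- The common limit of the quotients `slopeL`. -/
noncomputable def slopeLim (p : Params) (W : State) : Fin 4 → ℝ :=
  ![-(W.h / soundSpeed p W), W.h - W.u * (W.h / soundSpeed p W),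
    W.sxx * W.h / soundSpeed p W, -(W.szz * (W.h / soundSpeed p W) * 3)]

lemma StateTendsto.tendsto_slopeL (p : Params) (hL : StateTendsto l L W) (hR : StateTendsto l R W)
    (hW : W.Admissible) (h : 0 < W.h) (k : Fin 4) :
    Tendsto (fun a => slopeL p (L a) (R a) k) l (𝓝 (slopeLim p W k)) := by
  have ha := (soundSpeed_pos p hW).ne'
  have hq := (hL.tendsto_hStarL p hR hW h).div (hL.tendsto_ratioL p hR hW h) ha
  fin_cases k
  · exact hq.neg
  · exact (hL.tendsto_hStarL p hR hW h).sub (hL.u.mul hq)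
  · exact (hL.sxx.mul hL.h).div (hL.tendsto_ratioL p hR hW h) ha
  · have := (((hL.szz.mul hq).mul ((((hL.tendsto_hStarL p hR hW h).pow 2).add
      ((hL.tendsto_hStarL p hR hW h).mul hL.h)).add (hL.h.pow 2))).div (hL.h.pow 2)
      (pow_ne_zero 2 h.ne')).neg
    refine this.trans_eq ?_
    congr 1
    simp only [slopeLim, Fin.reduceFinMk, Matrix.cons_val]
    field_simp
    ring

/-- The limit of the quotients `slopeR`. -/
noncomputable def slopeLimR (p : Params) (W : State) : Fin 4 → ℝ :=
  ![-slopeLim p W.mirror 0, slopeLim p W.mirror 1, -slopeLim p W.mirror 2,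
    -slopeLim p W.mirror 3]

lemma StateTendsto.tendsto_slopeR (p : Params) (hL : StateTendsto l L W) (hR : StateTendsto l R W)
    (hW : W.Admissible) (h : 0 < W.h) (k : Fin 4) :
    Tendsto (fun a => slopeR p (L a) (R a) k) l (𝓝 (slopeLimR p W k)) := by
  have := hR.mirror.tendsto_slopeL p hL.mirror hW.mirror h
  fin_cases k
  · exact (this 0).neg
  · exact this 1
  · exact (this 2).neg
  · exact (this 3).neg

/-- Mass conservation across the first wave gives `h^* (u_* - u_l) = w (h_l - h^*)`, so every jump
is a multiple of the velocity jump. For `h σzz` the jump is a difference of cubes of heights, whence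
the quadratic factor in `slopeL`. -/
lemma starL_cons_sub {L R : State} (p : Params) (hL : L.Admissible) (hR : R.Admissible)
    (h : 0 < L.h) (k : Fin 4) :
    (starL p L R).cons k - L.cons k = (uStar p L R - L.u) * slopeL p L R k := by
  have hs := hStarL_pos p hL hR h
  have hw := ratioL_pos p hL hR
  have e : hStarL p L R * (uStar p L R - L.u) =
      ratioL p L R * (L.h - hStarL p L R) := by
    have := hStarL_mul p hL hR
    simp only [speed1, speed2, cL] at this
    linarith
  have hh : hStarL p L R - L.h =
      (uStar p L R - L.u) * -(hStarL p L R / ratioL p L R) := by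
    field_simp
    linarith
  fin_cases k
  · exact hh
  · change hStarL p L R * uStar p L R - L.h * L.u = (uStar p L R - L.u) *
      (hStarL p L R - L.u * (hStarL p L R / ratioL p L R))
    linear_combination L.u * hh
  · change hStarL p L R * (L.sxx * (L.h / hStarL p L R) ^ 2) - L.h * L.sxx =
      (uStar p L R - L.u) * (L.sxx * L.h / ratioL p L R)
    field_simp
    linear_combination -L.sxx * e
  · change hStarL p L R * (L.szz * (hStarL p L R / L.h) ^ 2) - L.h * L.szz =
      (uStar p L R - L.u) * -(L.szz * (hStarL p L R / ratioL p L R) *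
      (hStarL p L R ^ 2 + hStarL p L R * L.h + L.h ^ 2) / L.h ^ 2)
    rw [show (uStar p L R - L.u) * -(L.szz * (hStarL p L R / ratioL p L R) *
      (hStarL p L R ^ 2 + hStarL p L R * L.h + L.h ^ 2) / L.h ^ 2) =
      ((uStar p L R - L.u) * -(hStarL p L R / ratioL p L R)) * (L.szz *
      (hStarL p L R ^ 2 + hStarL p L R * L.h + L.h ^ 2) / L.h ^ 2) by ring, ← hh]
    field_simp
    ring

lemma cons_sub_starR {L R : State} (p : Params) (hL : L.Admissible) (hR : R.Admissible)
    (h : 0 < R.h) (k : Fin 4) :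
    R.cons k - (starR p L R).cons k = (R.u - uStar p L R) * slopeR p L R k := by
  have H := starL_cons_sub p hR.mirror hL.mirror h
  rw [uStar_mirror, starL_mirror] at H
  fin_cases k
  · have := H 0
    simp only [State.cons, State.mirror_h, State.mirror_u, Matrix.cons_val_zero] at this
    simp [State.cons, slopeR]
    linarith
  · have := H 1
    simp only [State.cons, State.mirror_h, State.mirror_u, Matrix.cons_val_one,
      Matrix.cons_val_zero] at this
    simp [State.cons, slopeR]
    linarith
  · have := H 2
    simp only [State.cons, State.mirror_h, State.mirror_u, State.mirror_sxx,
      Matrix.cons_val] at this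
    simp [State.cons, slopeR]
    linarith
  · have := H 3
    simp only [State.cons, State.mirror_h, State.mirror_u, State.mirror_szz,
      Matrix.cons_val] at this
    simp [State.cons, slopeR]
    linarith

/-- The sum over the left-going waves in terms of the slopes. -/
lemma leftSum_cons_eq {L R : State} (p : Params) (hL : L.Admissible) (hR : R.Admissible)
    (hLh : 0 < L.h) (hRh : 0 < R.h) (k : Fin 4) :
    leftSum p (fun V => V.cons k) L R =
      (min 0 (speed1 p L R) - min 0 (speed2 p L R)) *
          ((uStar p L R - L.u) * slopeL p L R k) +
        min 0 (speed2 p L R) * (R.cons k - L.cons k) +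
        (min 0 (speed3 p L R) - min 0 (speed2 p L R)) *
          ((R.u - uStar p L R) * slopeR p L R k) := by
  rw [← starL_cons_sub p hL hR hLh, ← cons_sub_starR p hL hR hRh, leftSum]
  ring

/-- The jump of the fluxes in terms of the slopes. -/
lemma waves_cons_eq {L R : State} (p : Params) (hL : L.Admissible) (hR : R.Admissible)
    (hLh : 0 < L.h) (hRh : 0 < R.h) (k : Fin 4) :
    (R.cons k * R.u - rightSum p (fun V => V.cons k) L R) -
        (L.cons k * L.u + leftSum p (fun V => V.cons k) L R) =
      (uStar p L R - L.u) *
          (L.cons k + (uStar p L R - speed1 p L R) * slopeL p L R k) +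
        (R.u - uStar p L R) *
          (R.cons k - (speed3 p L R - uStar p L R) * slopeR p L R k) := by
  have h1 := starL_cons_sub p hL hR hLh k
  have h2 := cons_sub_starR p hL hR hRh k
  have h3 := leftSum_add_rightSum p (fun V => V.cons k) L R
  have : speed2 p L R = uStar p L R := rfl
  rw [this] at h3
  linear_combination -h3 + (uStar p L R - speed1 p L R) * h1 - (speed3 p L R - uStar p L R) * h2

lemma StateTendsto.tendsto_uStar_sub (p : Params) (hL : StateTendsto l L W)
    (hR : StateTendsto l R W)
    (hW : W.Admissible) (h : 0 < W.h) :
    Tendsto (fun a => uStar p (L a) (R a) - (L a).u) l (𝓝 0) := by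
  simpa using (hL.tendsto_uStar p hR hW h).sub hL.u

lemma StateTendsto.tendsto_sub_uStar (p : Params) (hL : StateTendsto l L W)
    (hR : StateTendsto l R W)
    (hW : W.Admissible) (h : 0 < W.h) :
    Tendsto (fun a => (R a).u - uStar p (L a) (R a)) l (𝓝 0) := by
  simpa using hR.u.sub (hL.tendsto_uStar p hR hW h)

lemma StateTendsto.tendsto_leftSum (p : Params) (hL : StateTendsto l L W) (hR : StateTendsto l R W)
    (hW : W.Admissible) (h : 0 < W.h) (k : Fin 4) :
    Tendsto (fun a => leftSum p (fun V => V.cons k) (L a) (R a)) l (𝓝 0) := by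
  have m1 := (tendsto_const_nhds (x := (0 : ℝ))).min (hL.tendsto_speed1 p hR hW h)
  have m2 := (tendsto_const_nhds (x := (0 : ℝ))).min (hL.tendsto_uStar p hR hW h)
  have m3 := (tendsto_const_nhds (x := (0 : ℝ))).min (hL.tendsto_speed3 p hR hW h)
  have := (((m1.sub m2).mul ((hL.tendsto_uStar_sub p hR hW h).mul
    (hL.tendsto_slopeL p hR hW h k))).add
    (m2.mul ((hR.tendsto_cons k).sub (hL.tendsto_cons k)))).add
    ((m3.sub m2).mul ((hL.tendsto_sub_uStar p hR hW h).mul (hL.tendsto_slopeR p hR hW h k)))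
  simp only [zero_mul, mul_zero, sub_self, add_zero] at this
  refine this.congr' ?_
  filter_upwards [hL.eventually_wet hW h, hR.eventually_wet hW h] with a h1 h2
  exact (leftSum_cons_eq p h1.1 h2.1 h1.2 h2.2 k).symm

lemma StateTendsto.tendsto_sharpL (hL : StateTendsto l L W) (hdb : Tendsto db l (𝓝 0))
    (h : 0 < W.h) : StateTendsto l (fun a => sharpL (L a) (db a)) W := by
  refine ⟨?_, hL.u, hL.sxx, hL.szz⟩
  have := (tendsto_const_nhds (x := (0 : ℝ))).max
    (hL.h.sub ((tendsto_const_nhds (x := (0 : ℝ))).max hdb))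
  simpa [sharpL, h.le] using this

lemma StateTendsto.tendsto_sharpR (hR : StateTendsto l R W) (hdb : Tendsto db l (𝓝 0))
    (h : 0 < W.h) : StateTendsto l (fun a => sharpR (R a) (db a)) W := by
  simpa [sharpL, sharpR] using hR.tendsto_sharpL
    (db := fun a => -db a) (by simpa using hdb.neg) h

/-- The flux per unit height, without the hydrostatic part of the pressure. -/
noncomputable def massSpeeds (p : Params) (W : State) : Fin 4 → ℝ :=
  ![W.u, W.u ^ 2 + p.etap / (2 * p.lam) * (W.szz - W.sxx), W.sxx * W.u, W.szz * W.u]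

lemma StateTendsto.tendsto_massSpeeds (p : Params) (hL : StateTendsto l L W) (k : Fin 4) :
    Tendsto (fun a => massSpeeds p (L a) k) l (𝓝 (massSpeeds p W k)) := by
  fin_cases k
  · exact hL.u
  · exact (hL.u.pow 2).add ((hL.szz.sub hL.sxx).const_mul _)
  · exact hL.sxx.mul hL.u
  · exact hL.szz.mul hL.u

/-- The hydrostatic correction cancels the quadratic effect of lowering the height, and the
remaining flux is linear in `h`. The hypothesis on `d` keeps the cut-off at zero inactive. -/
lemma fluxL_eq_of_le {L R : State} (p : Params) (hL : L.Admissible) (hR : R.Admissible) {d : ℝ}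
    (hd : max 0 d ≤ L.h) (k : Fin 4) :
    fluxL p L R d k = flux p L k - max 0 d * massSpeeds p L k +
      leftSum p (fun V => V.cons k) (sharpL L d) (sharpR R d) := by
  rw [fluxL, Pi.add_apply, baseFluxL_eq p (sharpL_admissible hL d) (sharpR_admissible hR d)]
  have : (sharpL L d).h = L.h - max 0 d := max_eq_right (by linarith)
  have hu : (sharpL L d).u = L.u := rfl
  have hx : (sharpL L d).sxx = L.sxx := rfl
  have hz : (sharpL L d).szz = L.szz := rfl
  fin_cases k <;> simp [flux, massSpeeds, pressure, this, hu, hx, hz] <;> ring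

lemma StateTendsto.eventually_max_le (hL : StateTendsto l L W) (hdb : Tendsto db l (𝓝 0))
    (h : 0 < W.h) : ∀ᶠ a in l, max 0 (db a) ≤ (L a).h := by
  have h1 : Tendsto (fun a => max 0 (db a)) l (𝓝 0) := by
    simpa using (tendsto_const_nhds (x := (0 : ℝ))).max hdb
  filter_upwards [h1.eventually_lt hL.h h] with a ha using ha.le

lemma StateTendsto.tendsto_fluxL (p : Params) (hL : StateTendsto l L W) (hR : StateTendsto l R W)
    (hdb : Tendsto db l (𝓝 0)) (hW : W.Admissible) (h : 0 < W.h) (k : Fin 4) :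
    Tendsto (fun a => fluxL p (L a) (R a) (db a) k) l (𝓝 (flux p W k)) := by
  have h1 : Tendsto (fun a => max 0 (db a)) l (𝓝 0) := by
    simpa using (tendsto_const_nhds (x := (0 : ℝ))).max hdb
  have := ((hL.tendsto_flux p k).sub (h1.mul (hL.tendsto_massSpeeds p k))).add
    ((hL.tendsto_sharpL hdb h).tendsto_leftSum p (hR.tendsto_sharpR hdb h) hW h k)
  simp only [zero_mul, sub_zero, add_zero] at this
  refine this.congr' ?_
  filter_upwards [hL.eventually_wet hW h, hR.eventually_wet hW h,
    hL.eventually_max_le hdb h] with a h1 h2 h3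
  exact (fluxL_eq_of_le p h1.1 h2.1 h3 k).symm

end Limits

/-! ### First-order expansion of the flux jump, and continuity of the right flux. -/

section Jumps

variable {α : Type*} {l : Filter α} {p : Params} {L R : α → State} {W : State}
  {db e f g : α → ℝ} {c : ℝ}

lemma isBigO_mul_of_tendsto (hf : f =O[l] e) (hg : Tendsto g l (𝓝 c)) :
    (fun a => f a * g a) =O[l] e := by
  simpa using hf.mul (hg.isBigO_one ℝ)

lemma isLittleO_mul_of_tendsto (hf : f =O[l] e) (hg : Tendsto g l (𝓝 0)) :
    (fun a => f a * g a) =o[l] e := by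
  simpa using hf.mul_isLittleO ((isLittleO_one_iff ℝ).2 hg)

/-- The differences of the components are `O(e)`. -/
structure DiffIsBigO (l : Filter α) (L R : α → State) (e : α → ℝ) : Prop where
  h : (fun a => (R a).h - (L a).h) =O[l] e
  u : (fun a => (R a).u - (L a).u) =O[l] e
  sxx : (fun a => (R a).sxx - (L a).sxx) =O[l] e
  szz : (fun a => (R a).szz - (L a).szz) =O[l] e

lemma pressure_sub (p : Params) (L R : State) : pressure p R - pressure p L =
    (R.h - L.h) * (p.g * (R.h + L.h) / 2 + p.etap / (2 * p.lam) * (R.szz - R.sxx)) +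
      ((R.szz - L.szz) - (R.sxx - L.sxx)) * (p.etap / (2 * p.lam) * L.h) := by
  simp only [pressure]; ring

lemma DiffIsBigO.pressure (p : Params) (hL : StateTendsto l L W) (hR : StateTendsto l R W)
    (hd : DiffIsBigO l L R e) :
    (fun a => pressure p (R a) - pressure p (L a)) =O[l] e := by
  simp only [pressure_sub]
  exact (isBigO_mul_of_tendsto hd.h ((((hR.h.add hL.h).const_mul p.g).div_const 2).add
    ((hR.szz.sub hR.sxx).const_mul _))).add
    (isBigO_mul_of_tendsto (hd.szz.sub hd.sxx) (hL.h.const_mul _))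

lemma StateTendsto.tendsto_weight (p : Params) (hL : StateTendsto l L W)
    (hR : StateTendsto l R W) (hW : W.Admissible) (h : 0 < W.h) :
    Tendsto (fun a => 1 / (cL p (L a) (R a) + cR p (L a) (R a))) l
      (𝓝 (1 / (W.h * soundSpeed p W + W.h * soundSpeed p W))) := by
  have hc := mul_pos h (soundSpeed_pos p hW)
  exact tendsto_const_nhds.div ((hL.tendsto_cL p hR hW h).add (hL.tendsto_cR p hR hW h))
    (by positivity)

lemma StateTendsto.uStar_sub_eventuallyEq (p : Params) (hL : StateTendsto l L W)
    (hR : StateTendsto l R W) (hW : W.Admissible) (h : 0 < W.h) :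
    (fun a => uStar p (L a) (R a) - (L a).u) =ᶠ[l] fun a =>
      ((R a).u - (L a).u) * (cR p (L a) (R a) * (1 / (cL p (L a) (R a) + cR p (L a) (R a)))) -
        (pressure p (R a) - pressure p (L a)) *
          (1 / (cL p (L a) (R a) + cR p (L a) (R a))) := by
  filter_upwards [hL.eventually_wet hW h, hR.eventually_wet hW h] with a h1 h2
  rw [uStar_sub_left p (cL_add_cR_pos p h1.1 h2.1 (add_pos h1.2 h2.2)).ne']
  ring

lemma DiffIsBigO.uStar_sub (p : Params) (hL : StateTendsto l L W)
    (hR : StateTendsto l R W)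
    (hW : W.Admissible) (h : 0 < W.h) (hd : DiffIsBigO l L R e) :
    (fun a => uStar p (L a) (R a) - (L a).u) =O[l] e := by
  refine IsBigO.congr' ?_ (hL.uStar_sub_eventuallyEq p hR hW h).symm EventuallyEq.rfl
  have hw := hL.tendsto_weight p hR hW h
  exact (isBigO_mul_of_tendsto hd.u ((hL.tendsto_cR p hR hW h).mul hw)).sub
    (isBigO_mul_of_tendsto (hd.pressure p hL hR) hw)

lemma DiffIsBigO.sub_uStar (p : Params) (hL : StateTendsto l L W)
    (hR : StateTendsto l R W)
    (hW : W.Admissible) (h : 0 < W.h) (hd : DiffIsBigO l L R e) :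
    (fun a => (R a).u - uStar p (L a) (R a)) =O[l] e := by
  refine (hd.u.sub (hd.uStar_sub p hL hR hW h)).congr_left fun a => ?_
  ring

/-- The nonconservative products of the stress equations, to first order. -/
lemma DiffIsBigO.stress_jump (p : Params) (hL : StateTendsto l L W) (hR : StateTendsto l R W)
    (hW : W.Admissible) (h : 0 < W.h) (hd : DiffIsBigO l L R e) (k : Fin 4) {s : ℝ}
    (h1 : W.cons k + soundSpeed p W * slopeLim p W k = s)
    (h2 : W.cons k - soundSpeed p W * slopeLimR p W k = s) :
    (fun a => ((R a).cons k * (R a).u - rightSum p (fun V => V.cons k) (L a) (R a)) -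
        ((L a).cons k * (L a).u + leftSum p (fun V => V.cons k) (L a) (R a)) -
        s * ((R a).u - (L a).u)) =o[l] e := by
  have hu := hL.tendsto_uStar p hR hW h
  have t1 := (hL.tendsto_cons k).add
    ((hu.sub (hL.tendsto_speed1 p hR hW h)).mul (hL.tendsto_slopeL p hR hW h k))
  have t2 := (hR.tendsto_cons k).sub
    (((hL.tendsto_speed3 p hR hW h).sub hu).mul (hL.tendsto_slopeR p hR hW h k))
  have t1 := t1.sub_const s
  have t2 := t2.sub_const s
  rw [sub_sub_cancel, h1, sub_self] at t1
  rw [add_sub_cancel_left, h2, sub_self] at t2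
  -- The coefficients of `u_* - u_l` and of `u_r - u_*` have the common limit `s`, so only the total
  -- velocity jump remains at first order.
  refine IsLittleO.congr' ((isLittleO_mul_of_tendsto (hd.uStar_sub p hL hR hW h) t1).add
    (isLittleO_mul_of_tendsto (hd.sub_uStar p hL hR hW h) t2)) ?_ EventuallyEq.rfl
  filter_upwards [hL.eventually_wet hW h, hR.eventually_wet hW h] with a w1 w2
  rw [waves_cons_eq p w1.1 w2.1 w1.2 w2.2]
  ring

lemma tendsto_max_zero (hdb : Tendsto db l (𝓝 0)) : Tendsto (fun a => max 0 (db a)) l (𝓝 0) := by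
  simpa using (tendsto_const_nhds (x := (0 : ℝ))).max hdb

lemma isBigO_max_zero (hdb : db =O[l] e) : (fun a => max 0 (db a)) =O[l] e := by
  refine (IsBigO.of_bound 1 (Eventually.of_forall fun a => ?_)).trans hdb
  rw [one_mul, Real.norm_of_nonneg (le_max_left _ _), Real.norm_eq_abs]
  exact max_le (abs_nonneg _) (le_abs_self _)

lemma max_neg_eq (d : ℝ) : max 0 (-d) = max 0 d - d := by
  rcases le_total 0 d with h | h
  · rw [max_eq_left (by linarith), max_eq_right h]; ring
  · rw [max_eq_right (by linarith), max_eq_left h]; ring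

/-- Away from dry states the reconstructed heights jump like the free surface `h + b`; the positive
parts cancel by `max_neg_eq`. -/
lemma StateTendsto.sharp_sub_eventuallyEq (hL : StateTendsto l L W) (hR : StateTendsto l R W)
    (hdb : Tendsto db l (𝓝 0)) (h : 0 < W.h) :
    (fun a => (sharpR (R a) (db a)).h - (sharpL (L a) (db a)).h) =ᶠ[l] fun a =>
      (R a).h - (L a).h + db a := by
  filter_upwards [hL.eventually_max_le hdb h,
    hR.eventually_max_le (db := fun a => -db a) (by simpa using hdb.neg) h] with a h1 h2
  simp only [sharpL, sharpR]
  rw [max_eq_right (sub_nonneg.2 h1), max_eq_right (sub_nonneg.2 h2), max_neg_eq]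
  ring

lemma DiffIsBigO.sharp (hL : StateTendsto l L W) (hR : StateTendsto l R W)
    (hdb : Tendsto db l (𝓝 0)) (h : 0 < W.h) (hd : DiffIsBigO l L R e) (hdbe : db =O[l] e) :
    DiffIsBigO l (fun a => sharpL (L a) (db a)) (fun a => sharpR (R a) (db a)) e :=
  ⟨(hd.h.add hdbe).congr' (hL.sharp_sub_eventuallyEq hR hdb h).symm EventuallyEq.rfl,
    hd.u, hd.sxx, hd.szz⟩

/-- The difference of the numerical fluxes across an interface, to first order. -/
lemma DiffIsBigO.flux_jump (p : Params) (hL : StateTendsto l L W) (hR : StateTendsto l R W)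
    (hdb : Tendsto db l (𝓝 0)) (hW : W.Admissible) (h : 0 < W.h) (hd : DiffIsBigO l L R e)
    (hdbe : db =O[l] e) (k : Fin 4) :
    (fun a => fluxR p (L a) (R a) (db a) k - fluxL p (L a) (R a) (db a) k -
      source p W (db a) ((R a).u - (L a).u) k) =o[l] e := by
  have hLs := hL.tendsto_sharpL hdb h
  have hRs := hR.tendsto_sharpR hdb h
  have hds := hd.sharp hL hR hdb h hdbe
  have ha := (soundSpeed_pos p hW).ne'
  have hh := h.ne'
  fin_cases k
  · refine (isLittleO_zero e l).congr_left fun a => ?_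
    simp [fluxL, fluxR, baseFluxL, baseFluxR, source]
  · have hdb' : Tendsto (fun a => -db a) l (𝓝 0) := by simpa using hdb.neg
    have hX := isBigO_max_zero hdbe
    have hY := isBigO_max_zero (db := fun a => -db a) hdbe.neg_left
    -- Expanding the squares, the momentum remainder is `(Δb)₊` times the first bracket plus
    -- `(-Δb)₊` times the second; both brackets tend to zero.
    have t1 : Tendsto (fun a => p.g * (max 0 (db a) / 2 - ((L a).h - W.h))) l (𝓝 0) := by
      simpa using (((tendsto_max_zero hdb).div_const 2).sub (hL.h.sub_const W.h)).const_mul p.g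
    have t2 : Tendsto (fun a => p.g * ((R a).h - W.h - max 0 (-db a) / 2)) l (𝓝 0) := by
      simpa using ((hR.h.sub_const W.h).sub ((tendsto_max_zero hdb').div_const 2)).const_mul p.g
    refine IsLittleO.congr' ((isLittleO_mul_of_tendsto hX t1).add
      (isLittleO_mul_of_tendsto hY t2)) ?_ EventuallyEq.rfl
    filter_upwards [hL.eventually_max_le hdb h, hR.eventually_max_le hdb' h] with a h1 h2
    have e1 : (sharpL (L a) (db a)).h = (L a).h - max 0 (db a) :=
      max_eq_right (sub_nonneg.2 h1)
    have e2 : (sharpR (R a) (db a)).h = (R a).h - max 0 (-db a) :=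
      max_eq_right (sub_nonneg.2 h2)
    simp only [fluxL, fluxR, baseFluxL, baseFluxR, source, Pi.add_apply, Fin.mk_one,
      Matrix.cons_val_one, Matrix.cons_val_zero, e1, e2, max_neg_eq]
    ring
  · refine (hds.stress_jump p hLs hRs hW h 2 (s := 2 * (W.h * W.sxx)) ?_ ?_).congr' ?_
      EventuallyEq.rfl
    · simp [slopeLim, State.cons]; field_simp; ring
    · simp [slopeLim, slopeLimR, State.cons]; field_simp; ring
    · filter_upwards [hL.eventually_wet hW h, hR.eventually_wet hW h] with a w1 w2
      simp only [Fin.reduceFinMk]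
      rw [(fluxL_apply p w1.1 w2.1 _).2.2.1, (fluxR_apply p w1.1 w2.1 _).2.2.1]
      simp [leftFlux, rightFlux, source, State.cons, sharpL, sharpR]
  · refine (hds.stress_jump p hLs hRs hW h 3 (s := -(2 * (W.h * W.szz))) ?_ ?_).congr' ?_
      EventuallyEq.rfl
    · simp [slopeLim, State.cons]; field_simp; ring
    · simp [slopeLim, slopeLimR, State.cons]; field_simp; ring
    · filter_upwards [hL.eventually_wet hW h, hR.eventually_wet hW h] with a w1 w2
      simp only [Fin.reduceFinMk]
      rw [(fluxL_apply p w1.1 w2.1 _).2.2.2, (fluxR_apply p w1.1 w2.1 _).2.2.2]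
      simp [leftFlux, rightFlux, source, State.cons, sharpL, sharpR]

/-- Continuity is inherited from the left flux: the jump expansion with scale `e = 1` shows that the
two fluxes have the same limit. -/
lemma StateTendsto.tendsto_fluxR (p : Params) (hL : StateTendsto l L W)
    (hR : StateTendsto l R W) (hdb : Tendsto db l (𝓝 0)) (hW : W.Admissible) (h : 0 < W.h)
    (k : Fin 4) : Tendsto (fun a => fluxR p (L a) (R a) (db a) k) l (𝓝 (flux p W k)) := by
  have hd : DiffIsBigO l L R (fun _ => (1 : ℝ)) :=
    ⟨(hR.h.sub hL.h).isBigO_one ℝ, (hR.u.sub hL.u).isBigO_one ℝ,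
      (hR.sxx.sub hL.sxx).isBigO_one ℝ, (hR.szz.sub hL.szz).isBigO_one ℝ⟩
  have h1 := (isLittleO_one_iff ℝ).1 (hd.flux_jump p hL hR hdb hW h (hdb.isBigO_one ℝ) k)
  have hu : Tendsto (fun a => (R a).u - (L a).u) l (𝓝 0) := by simpa using hR.u.sub hL.u
  have h2 : Tendsto (fun a => source p W (db a) ((R a).u - (L a).u) k) l (𝓝 0) := by
    fin_cases k
    · exact tendsto_const_nhds
    · simpa [source] using (hdb.const_mul (p.g * W.h)).neg
    · simpa [source] using hu.const_mul (2 * (W.h * W.sxx))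
    · simpa [source] using (hu.const_mul (2 * (W.h * W.szz))).neg
  have := (h1.add h2).add (hL.tendsto_fluxL p hR hdb hW h k)
  simp only [add_zero, zero_add] at this
  refine this.congr fun a => ?_
  ring

/-! Neighbourhoods of a state -/

/-- The filter of pairs of states and bottom jumps that approach a constant state. -/
noncomputable def nearState (W : State) : Filter (State × State × ℝ) :=
  comap (fun z => z.1.sep W + z.2.1.sep W + |z.2.2|) (𝓝 0)

lemma State.sep_nonneg (V W : State) : 0 ≤ V.sep W := by
  unfold State.sep; positivity

lemma eventually_nearState {P : State × State × ℝ → Prop} (hP : ∀ᶠ z in nearState W, P z) :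
    ∃ δ > 0, ∀ (L R : State) (db : ℝ), L.sep W + R.sep W + |db| < δ → P (L, R, db) := by
  rw [nearState, eventually_comap, Metric.eventually_nhds_iff] at hP
  obtain ⟨δ, hδ, H⟩ := hP
  refine ⟨δ, hδ, fun L R db hz => H ?_ (L, R, db) rfl⟩
  rw [Real.dist_eq, sub_zero, abs_of_nonneg]
  · exact hz
  · have := L.sep_nonneg W
    have := R.sep_nonneg W
    positivity

lemma tendsto_of_abs_sub_le {f s : α → ℝ} (hs : Tendsto s l (𝓝 0)) (h : ∀ a, |f a - c| ≤ s a) :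
    Tendsto f l (𝓝 c) :=
  tendsto_iff_norm_sub_tendsto_zero.2
    (squeeze_zero (fun _ => norm_nonneg _) h hs)

lemma tendsto_of_sep (L : α → State) {s : α → ℝ} (hs : Tendsto s l (𝓝 0))
    (h : ∀ a, (L a).sep W ≤ s a) : StateTendsto l L W := by
  have h' (a : α) : |(L a).h - W.h| + |(L a).u - W.u| + |(L a).sxx - W.sxx| +
    |(L a).szz - W.szz| ≤ s a := h a
  constructor <;> refine tendsto_of_abs_sub_le hs fun a => ?_ <;>
    linarith [h' a, abs_nonneg ((L a).h - W.h), abs_nonneg ((L a).u - W.u),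
      abs_nonneg ((L a).sxx - W.sxx), abs_nonneg ((L a).szz - W.szz)]

lemma tendsto_nearState (W : State) :
    StateTendsto (nearState W) (fun z => z.1) W ∧ StateTendsto (nearState W) (fun z => z.2.1) W ∧
      Tendsto (fun z : State × State × ℝ => z.2.2) (nearState W) (𝓝 0) := by
  have hs : Tendsto (fun z : State × State × ℝ => z.1.sep W + z.2.1.sep W + |z.2.2|)
      (nearState W) (𝓝 0) := tendsto_comap
  refine ⟨tendsto_of_sep _ hs fun z => ?_, tendsto_of_sep _ hs fun z => ?_,
    tendsto_of_abs_sub_le hs fun z => ?_⟩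
  all_goals
    have := z.1.sep_nonneg W
    have := z.2.1.sep_nonneg W
    have := abs_nonneg z.2.2
    try rw [sub_zero]
    linarith

lemma consistent_flux_tendsto (p : Params) (hW : W.Admissible) (h : 0 < W.h) {ε : ℝ}
    (hε : 0 < ε) : ∃ δ > 0, ∀ (L R : State) (db : ℝ), L.sep W + R.sep W + |db| < δ →
      ∀ k : Fin 4, |fluxL p L R db k - flux p W k| < ε ∧ |fluxR p L R db k - flux p W k| < ε := by
  obtain ⟨hL, hR, hdb⟩ := tendsto_nearState W
  have (k : Fin 4) := (Metric.tendsto_nhds.1 (hL.tendsto_fluxL p hR hdb hW h k) ε hε).and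
    (Metric.tendsto_nhds.1 (hL.tendsto_fluxR p hR hdb hW h k) ε hε)
  exact eventually_nearState (eventually_all.2 this)

lemma consistent_flux_jump (p : Params) (hW : W.Admissible) (h : 0 < W.h) {ε : ℝ}
    (hε : 0 < ε) : ∃ δ > 0, ∀ (L R : State) (db : ℝ), L.sep W + R.sep W + |db| < δ →
      ∀ k : Fin 4, |fluxR p L R db k - fluxL p L R db k - source p W db (R.u - L.u) k| ≤
        ε * (L.sep R + |db|) := by
  obtain ⟨hL, hR, hdb⟩ := tendsto_nearState W
  set e : State × State × ℝ → ℝ := fun z => z.1.sep z.2.1 + |z.2.2| with he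
  have he0 (z : State × State × ℝ) : 0 ≤ e z := add_nonneg (State.sep_nonneg _ _) (abs_nonneg _)
  have bound {f : State × State × ℝ → ℝ} (hf : ∀ z, |f z| ≤ e z) : f =O[nearState W] e :=
    IsBigO.of_bound 1 (Eventually.of_forall fun z => by
      rw [one_mul, Real.norm_eq_abs, Real.norm_of_nonneg (he0 z)]; exact hf z)
  have hsep (z : State × State × ℝ) : e z = |z.1.h - z.2.1.h| + |z.1.u - z.2.1.u| +
    |z.1.sxx - z.2.1.sxx| + |z.1.szz - z.2.1.szz| + |z.2.2| := rfl
  have hd : DiffIsBigO (nearState W) (fun z => z.1) (fun z => z.2.1) e := by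
    constructor <;> refine bound fun z => ?_ <;> rw [abs_sub_comm, hsep] <;>
      linarith [abs_nonneg (z.1.h - z.2.1.h), abs_nonneg (z.1.u - z.2.1.u),
        abs_nonneg (z.1.sxx - z.2.1.sxx), abs_nonneg (z.1.szz - z.2.1.szz), abs_nonneg z.2.2]
  have hdbe : (fun z : State × State × ℝ => z.2.2) =O[nearState W] e :=
    bound fun z => by linarith [State.sep_nonneg z.1 z.2.1, show e z = _ from rfl]
  have (k : Fin 4) := (hd.flux_jump p hL hR hdb hW h hdbe k).bound hε
  obtain ⟨δ, hδ, H⟩ := eventually_nearState (eventually_all.2 this)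
  refine ⟨δ, hδ, fun L R db hz k => ?_⟩
  have := H L R db hz k
  rwa [Real.norm_eq_abs, Real.norm_of_nonneg (he0 _)] at this

end Jumps

/-! ### The truncation error along smooth solutions. -/

section Truncation

variable {α : Type*} {l : Filter α} {p : Params} {L R : α → State} {W : State}
  {db e : α → ℝ} {c : ℝ}

/-- The difference quotients of the components converge. -/
structure DiffTendsto (l : Filter α) (L R : α → State) (e : α → ℝ) (V : State) : Prop where
  h : Tendsto (fun a => ((R a).h - (L a).h) / e a) l (𝓝 V.h)
  u : Tendsto (fun a => ((R a).u - (L a).u) / e a) l (𝓝 V.u)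
  sxx : Tendsto (fun a => ((R a).sxx - (L a).sxx) / e a) l (𝓝 V.sxx)
  szz : Tendsto (fun a => ((R a).szz - (L a).szz) / e a) l (𝓝 V.szz)

lemma isBigO_of_div_tendsto {f : α → ℝ} (he : ∀ᶠ a in l, e a ≠ 0)
    (hf : Tendsto (fun a => f a / e a) l (𝓝 c)) : f =O[l] e := by
  refine (isBigO_mul_of_tendsto (isBigO_refl e l) hf).congr' ?_ EventuallyEq.rfl
  filter_upwards [he] with a ha using mul_div_cancel₀ _ ha

lemma DiffTendsto.isBigO {V : State} (he : ∀ᶠ a in l, e a ≠ 0) (hd : DiffTendsto l L R e V) :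
    DiffIsBigO l L R e :=
  ⟨isBigO_of_div_tendsto he hd.h, isBigO_of_div_tendsto he hd.u,
    isBigO_of_div_tendsto he hd.sxx, isBigO_of_div_tendsto he hd.szz⟩

/-- The limit of the difference quotients of the pressure. -/
noncomputable def pressureLim (p : Params) (W V : State) : ℝ :=
  V.h * (p.g * (W.h + W.h) / 2 + p.etap / (2 * p.lam) * (W.szz - W.sxx)) +
    (V.szz - V.sxx) * (p.etap / (2 * p.lam) * W.h)

lemma DiffTendsto.pressure {V : State} (p : Params) (hL : StateTendsto l L W)
    (hR : StateTendsto l R W) (hd : DiffTendsto l L R e V) :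
    Tendsto (fun a => (pressure p (R a) - pressure p (L a)) / e a) l
      (𝓝 (pressureLim p W V)) := by
  have := (hd.h.mul ((((hR.h.add hL.h).const_mul p.g).div_const 2).add
    ((hR.szz.sub hR.sxx).const_mul (p.etap / (2 * p.lam))))).add
    ((hd.szz.sub hd.sxx).mul (hL.h.const_mul (p.etap / (2 * p.lam))))
  refine this.congr fun a => ?_
  rw [pressure_sub]
  ring

/-- The limit of the difference quotients of the pseudo-conservative variables. -/
noncomputable def consLim (W V : State) : Fin 4 → ℝ :=
  ![V.h, V.h * W.u + W.h * V.u, V.h * W.sxx + W.h * V.sxx, V.h * W.szz + W.h * V.szz]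

lemma tendsto_mul_sub_div {f f' g g' : α → ℝ} {y z y' z' : ℝ} (hf' : Tendsto f' l (𝓝 y))
    (hg : Tendsto g l (𝓝 z)) (hf : Tendsto (fun a => (f a - f' a) / e a) l (𝓝 y'))
    (hgg : Tendsto (fun a => (g a - g' a) / e a) l (𝓝 z')) :
    Tendsto (fun a => (f a * g a - f' a * g' a) / e a) l (𝓝 (y' * z + y * z')) := by
  refine ((hf.mul hg).add (hf'.mul hgg)).congr fun a => ?_
  ring

lemma DiffTendsto.cons {V : State} (hL : StateTendsto l L W)
    (hR : StateTendsto l R W) (hd : DiffTendsto l L R e V) (k : Fin 4) :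
    Tendsto (fun a => ((R a).cons k - (L a).cons k) / e a) l (𝓝 (consLim W V k)) := by
  fin_cases k
  · exact hd.h
  · exact tendsto_mul_sub_div hL.h hR.u hd.h hd.u
  · exact tendsto_mul_sub_div hL.h hR.sxx hd.h hd.sxx
  · exact tendsto_mul_sub_div hL.h hR.szz hd.h hd.szz

/-- The limit is chosen before the families of states; this uniformity lets the same constant serve
both interfaces of a cell. -/
lemma exists_uStar_sub_lim (p : Params) (l : Filter α) (e : α → ℝ) (hW : W.Admissible)
    (h : 0 < W.h) (V : State) : ∃ c : ℝ, ∀ L R : α → State, StateTendsto l L W →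
      StateTendsto l R W → DiffTendsto l L R e V →
      Tendsto (fun a => (uStar p (L a) (R a) - (L a).u) / e a) l (𝓝 c) := by
  refine ⟨V.u * (W.h * soundSpeed p W * (1 / (W.h * soundSpeed p W + W.h * soundSpeed p W))) -
    pressureLim p W V * (1 / (W.h * soundSpeed p W + W.h * soundSpeed p W)),
    fun L R hL hR hd => ?_⟩
  have hw := hL.tendsto_weight p hR hW h
  refine ((hd.u.mul ((hL.tendsto_cR p hR hW h).mul hw)).sub
    ((hd.pressure p hL hR).mul hw)).congr' ?_
  filter_upwards [hL.uStar_sub_eventuallyEq p hR hW h] with a ha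
  rw [ha]
  ring

/-- The contribution of the waves to the left flux has a directional derivative that depends only
on the limit of the difference quotients. -/
lemma exists_leftSum_lim (p : Params) (l : Filter α) (e : α → ℝ) (hW : W.Admissible)
    (h : 0 < W.h) (V : State) (k : Fin 4) : ∃ c : ℝ, ∀ L R : α → State, StateTendsto l L W →
      StateTendsto l R W → DiffTendsto l L R e V →
      Tendsto (fun a => leftSum p (fun V => V.cons k) (L a) (R a) / e a) l (𝓝 c) := by
  obtain ⟨x, hx⟩ := exists_uStar_sub_lim p l e hW h V
  refine ⟨(min 0 (W.u - soundSpeed p W) - min 0 W.u) * (x * slopeLim p W k) +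
    min 0 W.u * consLim W V k +
    (min 0 (W.u + soundSpeed p W) - min 0 W.u) * ((V.u - x) * slopeLimR p W k),
    fun L R hL hR hd => ?_⟩
  have hx := hx L R hL hR hd
  have m1 := (tendsto_const_nhds (x := (0 : ℝ))).min (hL.tendsto_speed1 p hR hW h)
  have m2 := (tendsto_const_nhds (x := (0 : ℝ))).min (hL.tendsto_uStar p hR hW h)
  have m3 := (tendsto_const_nhds (x := (0 : ℝ))).min (hL.tendsto_speed3 p hR hW h)
  refine ((((m1.sub m2).mul (hx.mul (hL.tendsto_slopeL p hR hW h k))).add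
    (m2.mul (hd.cons hL hR k))).add
    ((m3.sub m2).mul ((hd.u.sub hx).mul (hL.tendsto_slopeR p hR hW h k)))).congr' ?_
  filter_upwards [hL.eventually_wet hW h, hR.eventually_wet hW h] with a h1 h2
  rw [leftSum_cons_eq p h1.1 h2.1 h1.2 h2.2 k,
    show speed2 p (L a) (R a) = uStar p (L a) (R a) from rfl]
  ring

/-- After reconstruction, the slope of the height is replaced by that of the free surface, and the
other slopes are unchanged. -/
lemma DiffTendsto.sharp {V : State} (hL : StateTendsto l L W) (hR : StateTendsto l R W)
    (hdb : Tendsto db l (𝓝 0)) (h : 0 < W.h) (hd : DiffTendsto l L R e V)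
    (hdbe : Tendsto (fun a => db a / e a) l (𝓝 c)) :
    DiffTendsto l (fun a => sharpL (L a) (db a)) (fun a => sharpR (R a) (db a)) e
      ⟨V.h + c, V.u, V.sxx, V.szz⟩ := by
  refine ⟨(hd.h.add hdbe).congr' ?_, hd.u, hd.sxx, hd.szz⟩
  filter_upwards [hL.sharp_sub_eventuallyEq hR hdb h] with a ha
  rw [ha]
  ring

lemma forward_quotient {f : ℝ → ℝ} {f' x : ℝ} (hf : HasDerivAt f f' x) :
    Tendsto (fun d => (f (x + d) - f x) / d) (𝓝[>] 0) (𝓝 f') := by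
  refine hf.tendsto_slope_zero_right.congr fun d => ?_
  rw [smul_eq_mul]; ring

lemma backward_quotient {f : ℝ → ℝ} {f' x : ℝ} (hf : HasDerivAt f f' x) :
    Tendsto (fun d => (f x - f (x - d)) / d) (𝓝[>] 0) (𝓝 f') := by
  have h : HasDerivAt (fun y => -f (-y)) f' (-x) := by
    have := ((neg_neg x).symm ▸ hf : HasDerivAt f f' (- -x)).comp (-x) (hasDerivAt_neg (-x))
    have := this.neg
    rw [mul_neg_one, neg_neg] at this
    exact this
  refine (forward_quotient h).congr fun d => ?_
  rw [show -(-x + d) = x - d by ring, neg_neg]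
  ring

lemma tendsto_add_zero_right (x : ℝ) : Tendsto (fun d => x + d) (𝓝[>] 0) (𝓝 x) := by
  have : Tendsto (fun d => x + d) (𝓝 0) (𝓝 (x + 0)) :=
    (continuous_const.add continuous_id).tendsto 0
  simpa using this.mono_left nhdsWithin_le_nhds

lemma tendsto_sub_zero_right (x : ℝ) : Tendsto (fun d => x - d) (𝓝[>] 0) (𝓝 x) := by
  have : Tendsto (fun d => x - d) (𝓝 0) (𝓝 (x - 0)) :=
    (continuous_const.sub continuous_id).tendsto 0
  simpa using this.mono_left nhdsWithin_le_nhds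

lemma source_div (p : Params) (W : State) (y z d : ℝ) (k : Fin 4) :
    source p W y z k / d = source p W (y / d) (z / d) k := by
  fin_cases k <;> simp [source] <;> ring

lemma tendsto_source {y z : α → ℝ} {y' z' : ℝ} (p : Params) (W : State)
    (hy : Tendsto y l (𝓝 y')) (hz : Tendsto z l (𝓝 z')) (k : Fin 4) :
    Tendsto (fun a => source p W (y a) (z a) k) l (𝓝 (source p W y' z' k)) := by
  fin_cases k
  · exact tendsto_const_nhds
  · exact (hy.const_mul _).neg
  · exact hz.const_mul _
  · exact (hz.const_mul _).neg

/-- Consistency of the flux differences of a cell along a differentiable profile. -/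
lemma tendsto_spatial_quotient (p : Params) {W : ℝ → State} {b : ℝ → ℝ} {x b' D : ℝ} {V : State}
    (hW : (W x).Admissible) (h0 : 0 < (W x).h) (hb : HasDerivAt b b' x)
    (hh : HasDerivAt (fun y => (W y).h) V.h x) (hu : HasDerivAt (fun y => (W y).u) V.u x)
    (hsx : HasDerivAt (fun y => (W y).sxx) V.sxx x)
    (hsz : HasDerivAt (fun y => (W y).szz) V.szz x) (k : Fin 4)
    (hD : HasDerivAt (fun y => flux p (W y) k) D x) :
    Tendsto (fun d => (fluxL p (W x) (W (x + d)) (b (x + d) - b x) k -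
      fluxR p (W (x - d)) (W x) (b x - b (x - d)) k) / d) (𝓝[>] 0)
      (𝓝 (D - source p (W x) b' V.u k)) := by
  have he : ∀ᶠ d : ℝ in 𝓝[>] 0, d ≠ 0 := by
    filter_upwards [self_mem_nhdsWithin] with d hd using ne_of_gt hd
  have p1 := tendsto_add_zero_right x
  have p2 := tendsto_sub_zero_right x
  have hC := StateTendsto.const (𝓝[>] (0 : ℝ)) (W x)
  have hR : StateTendsto (𝓝[>] 0) (fun d => W (x + d)) (W x) :=
    ⟨hh.continuousAt.tendsto.comp p1, hu.continuousAt.tendsto.comp p1,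
      hsx.continuousAt.tendsto.comp p1, hsz.continuousAt.tendsto.comp p1⟩
  have hL : StateTendsto (𝓝[>] 0) (fun d => W (x - d)) (W x) :=
    ⟨hh.continuousAt.tendsto.comp p2, hu.continuousAt.tendsto.comp p2,
      hsx.continuousAt.tendsto.comp p2, hsz.continuousAt.tendsto.comp p2⟩
  have fh := forward_quotient hh
  have fu := forward_quotient hu
  have fx := forward_quotient hsx
  have fz := forward_quotient hsz
  have gh := backward_quotient hh
  have gu := backward_quotient hu
  have gx := backward_quotient hsx
  have gz := backward_quotient hsz
  have d1 : DiffTendsto (𝓝[>] 0) (fun _ => W x) (fun d => W (x + d)) (fun d => d) V :=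
    ⟨fh, fu, fx, fz⟩
  have d2 : DiffTendsto (𝓝[>] 0) (fun d => W (x - d)) (fun _ => W x) (fun d => d) V :=
    ⟨gh, gu, gx, gz⟩
  have q1 := forward_quotient hb
  have q2 := backward_quotient hb
  have b1 : Tendsto (fun d => b (x + d) - b x) (𝓝[>] 0) (𝓝 0) := by
    simpa using (hb.continuousAt.tendsto.comp p1).sub_const (b x)
  have b2 : Tendsto (fun d => b x - b (x - d)) (𝓝[>] 0) (𝓝 0) := by
    simpa using (hb.continuousAt.tendsto.comp p2).const_sub (b x)
  obtain ⟨c, hc⟩ := exists_leftSum_lim p (𝓝[>] (0 : ℝ)) (fun d => d) hW h0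
    ⟨V.h + b', V.u, V.sxx, V.szz⟩ k
  have s1 := hc _ _ (hC.tendsto_sharpL b1 h0) (hR.tendsto_sharpR b1 h0) (d1.sharp hC hR b1 h0 q1)
  have s2 := hc _ _ (hL.tendsto_sharpL b2 h0) (hC.tendsto_sharpR b2 h0) (d2.sharp hL hC b2 h0 q2)
  -- The corrections with `(Δb)₊` are themselves of first order, but at both interfaces they tend to
  -- the same multiple of `(b')₊` and cancel.
  have hmax {q : ℝ → ℝ} (hq : Tendsto (fun d => q d / d) (𝓝[>] 0) (𝓝 b')) :
      Tendsto (fun d => max 0 (q d) / d) (𝓝[>] 0) (𝓝 (max 0 b')) := by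
    refine (tendsto_const_nhds.max hq).congr' ?_
    filter_upwards [self_mem_nhdsWithin] with d hd
    rw [max_div_div_right (le_of_lt hd) 0 (q d) |>.symm, zero_div]
  have m1 := (hmax q1).mul (hC.tendsto_massSpeeds p k)
  have m2 := (hmax q2).mul (hL.tendsto_massSpeeds p k)
  have j := ((d2.isBigO he).flux_jump p hL hC b2 hW h0
    (isBigO_of_div_tendsto he q2) k).tendsto_div_nhds_zero
  have src := tendsto_source p (W x) q2 d2.u k
  -- The left flux is subtracted and added at the left interface: the difference of left fluxes
  -- gives `D`, all other first-order terms cancelling in pairs, and the flux jump at that interface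
  -- gives the source.
  have total := (((backward_quotient hD).sub (m1.sub m2)).add (s1.sub s2)).sub (j.add src)
  refine (total.congr' ?_).trans_eq (by congr 1; ring)
  filter_upwards [hC.eventually_max_le b1 h0, hL.eventually_max_le b2 h0,
    hR.eventually_wet hW h0, hL.eventually_wet hW h0] with d e1 e2 w1 w2
  rw [fluxL_eq_of_le p hW w1.1 e1, fluxL_eq_of_le p w2.1 hW e2, ← source_div]
  ring

/-- The time and space quotients converge separately, so no relation between the two step sizes is
needed; their limits add up to the residual of the system. -/
lemma truncation_error (p : Params) {b : ℝ → ℝ} {Ω : Set (ℝ × ℝ)} {W : ℝ → ℝ → State}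
    (hS : IsSmoothSolution p b Ω W) {t x : ℝ} (hx : (t, x) ∈ Ω) (k : Fin 4) :
    Tendsto (fun d : ℝ × ℝ =>
        ((W (t + d.1) x).cons k - (W t x).cons k) / d.1 +
          (fluxL p (W t x) (W t (x + d.2)) (b (x + d.2) - b x) k -
            fluxR p (W t (x - d.2)) (W t x) (b x - b (x - d.2)) k) / d.2)
        (𝓝[>] 0 ×ˢ 𝓝[>] 0) (𝓝 0) := by
  have slices {f : ℝ → ℝ → ℝ} (hf : ContDiffOn ℝ 1 (fun z : ℝ × ℝ => f z.1 z.2) Ω) :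
      DifferentiableAt ℝ (fun s => f s x) t ∧ DifferentiableAt ℝ (fun y => f t y) x := by
    have hd : DifferentiableAt ℝ (fun z : ℝ × ℝ => f z.1 z.2) (t, x) :=
      (hf.contDiffAt (hS.isOpen.mem_nhds hx)).differentiableAt one_ne_zero
    constructor
    · exact hd.comp t (f := fun s : ℝ => (s, x)) (by fun_prop)
    · exact hd.comp x (f := fun y : ℝ => (t, y)) (by fun_prop)
  obtain ⟨th, xh⟩ := slices (f := fun t x => (W t x).h) hS.contDiffOn_h
  obtain ⟨tu, xu⟩ := slices (f := fun t x => (W t x).u) hS.contDiffOn_u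
  obtain ⟨tsx, xsx⟩ := slices (f := fun t x => (W t x).sxx) hS.contDiffOn_sxx
  obtain ⟨tsz, xsz⟩ := slices (f := fun t x => (W t x).szz) hS.contDiffOn_szz
  have tcons : DifferentiableAt ℝ (fun s => (W s x).cons k) t := by
    fin_cases k
    · exact th
    · exact th.mul tu
    · exact th.mul tsx
    · exact th.mul tsz
  have xflux : DifferentiableAt ℝ (fun y => flux p (W t y) k) x := by
    fin_cases k
    · exact xh.mul xu
    · exact (xh.mul (xu.pow 2)).add ((((xh.pow 2).const_mul p.g).div_const 2).add
        ((xh.mul (xsz.sub xsx)).const_mul _))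
    · exact (xh.mul xsx).mul xu
    · exact (xh.mul xsz).mul xu
  have hb : HasDerivAt b (deriv b x) x :=
    (hS.contDiff_b.differentiable one_ne_zero x).hasDerivAt
  have h1 := forward_quotient tcons.hasDerivAt
  have h2 := tendsto_spatial_quotient p (V := ⟨deriv (fun y => (W t y).h) x,
    deriv (fun y => (W t y).u) x, deriv (fun y => (W t y).sxx) x, deriv (fun y => (W t y).szz) x⟩)
    ⟨(hS.h_pos t x hx).le, hS.sxx_pos t x hx, hS.szz_pos t x hx⟩ (hS.h_pos t x hx) hb
    xh.hasDerivAt xu.hasDerivAt xsx.hasDerivAt xsz.hasDerivAt k xflux.hasDerivAt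
  refine ((h1.comp tendsto_fst).add (h2.comp tendsto_snd)).trans_eq ?_
  congr 1
  linarith [hS.eqn t x hx k]

lemma consistent (p : Params) : Consistent p where
  flux_eq _ hW := flux_consistent p hW
  flux_tendsto _ hW h _ hε := consistent_flux_tendsto p hW h hε
  flux_jump _ hW h _ hε := consistent_flux_jump p hW h hε
  truncation _ _ _ hS _ _ hx k := truncation_error p hS hx k

end Truncation

end ViscoSV

theorem mainTheorem2 (p : ViscoSV.Params) :
    ViscoSV.Consistent p ∧
    ViscoSV.PositivityPreserving p ∧
    ViscoSV.ConservativeInHeight p ∧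
    (∃ Gn : ViscoSV.State → ViscoSV.State → ℝ → ℝ → ℝ, ViscoSV.SemiDiscreteEnergy p Gn) ∧
    ViscoSV.WellBalanced p := by
  exact ⟨ViscoSV.consistent p, ViscoSV.positivityPreserving p, ViscoSV.conservativeInHeight p,
    ⟨ViscoSV.numEnergyFlux p, ViscoSV.semiDiscreteEnergy p⟩, ViscoSV.wellBalanced p⟩
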